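/- **Setting.** Let $A$ be a finite alphabet. A subshift $W\subseteq A^{\mathbb Z^2}$ is a closed shift-invariant set; it has a *fully supported measure* if there is a shift-invariant Borel probability measure on $W$ that gives positive mass to every nonempty relatively open subset of $W$. A pattern is an element of $A^S$ with $S\subseteq\mathbb Z^2$ finite; it appears in $x$ if some translate of it is a restriction of $x$. *Entropy.* For an open cover $\mathcal U$ of a compact metrizable $\mathbb Z^2$-system $X$ let $h(X,\mathcal U)=\lim_n n^{-2}\log\mathcal N\big(\bigvee_{g\in[0,n)^2}g^{-1}\mathcal U\big)$, where $\mathcal N$ is the least cardinality of a subcover; the topological entropy of $X$ is the supremum of $h(X,\mathcal U)$ over all open covers. $X$ has *TCPE* if every topological factor of $X$ with more than one point has positive topological entropy. Distinct points $x,y\in X$ form an *entropy pair* if $h(X,\{K^c,K'^c\})>0$ for all disjoint closed neighbourhoods $K$ of $x$ and $K'$ of $y$. *TCPE hierarchy.* $E_1\subseteq X^2$ is the set of pairs that are equal or entropy pairs. $E_{\alpha+1}$ is the closure of $E_\alpha$ if $E_\alpha$ is not closed, the transitive symmetric closure of $E_\alpha$ if $E_\alpha$ is closed but not an equivalence relation,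 and $E_\alpha$ otherwise; $E_\lambda=\bigcup_{1\le\alpha<\lambda}E_\alpha$ for limit $\lambda$. The *TCPE rank* of $X$ is the least $\alpha\in[1,\omega_1)$ with $E_\alpha=X^2$, if there is one. *Generalized transitivity hierarchy.* $T_1\subseteq W^2$ is the set of transitivity pairs: $(x,x')\in W^2$ such that any pattern $v$ appearing in $x$ and any pattern $v'$ appearing in $x'$ both appear in a common point of $W$. $T_{\alpha+1}$ is the transitive closure of $T_\alpha$ if $T_\alpha$ is closed, and the closure of $T_\alpha$ otherwise; $T_\lambda=\bigcup_{1\le\alpha<\lambda}T_\alpha$ for limit $\lambda$. $W$ is *generalized transitive* if $T_\alpha=W^2$ for some $\alpha\in[1,\omega_1)$; the least such $\alpha$ is its *generalized transitivity rank*. *The fabric map $f$.* A ribbon family is a function $R:\mathbb Z\times\mathbb Z\to\mathbb Z$, $(i,n)\mapsto R_i(n)$, with $|R_i(n+1)-R_i(n)|\le1$, $|R_i(n+2)-R_i(n)|\le 1$ and $2\le R_{i+1}(n)-R_i(n)\le4$ for all $i,n$. Given ribbon families $H,V$, the $i$-th horizontal ribbon is $\{(n,H_i(n)):n\in\mathbb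 Z\}$ and the $j$-th vertical ribbon is $\{(V_j(m),m):m\in\mathbb Z\}$; they cross at the site $(n,H_i(n))$ with $n\le V_j(H_i(n))$ and $V_j(H_i(n+1))<n+1$ (there is exactly one). Let $B=\{*,-1,0,1\}\times\{*,-1,0,1\}\times(\{*\}\cup A)$. For $x\in A^{\mathbb Z^2}$ let $f(x)\subseteq B^{\mathbb Z^2}$ be the set of all $y$ obtained, from all ribbon families $H,V$, as follows: the first coordinate of $y(n,m)$ is $H_i(n+1)-H_i(n)$ if $m=H_i(n)$ for some $i$, and $*$ otherwise; the second is $V_j(m+1)-V_j(m)$ if $n=V_j(m)$ for some $j$, and $*$ otherwise; the third is $x(j,i)$ if the $i$-th horizontal and the $j$-th vertical ribbon cross at $(n,m)$, and $*$ if no ribbons cross there. Put $f(W)=\bigcup_{x\in W}f(x)$ and $f(T)=\bigcup_{(x,x')\in T}f(x)\times f(x')$ for $T\subseteq W^2$. **Theorem.** Let $W\subseteq A^{\mathbb Z^2}$ be a subshift with a fully supported measure. Then $f(W)$ is a subshift, and $f(W)$ has TCPE if and only if $W$ is generalized transitive; in this case the TCPE rank of $f(W)$ equals the generalized transitivity rank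 of $W$. Moreover, $f(T_\alpha)=E_\alpha$ for all $\alpha\in[1,\omega_1)$, where $T_\alpha$ and $E_\alpha$ are the relations of the two hierarchies on $W$ and on $f(W)$. -/

import Mathlib

open Set Filter Topology MeasureTheory

noncomputable section

namespace Fabric

universe u v

/-! ### Configurations, patterns and subshifts over `ℤ²` -/

/-- Configurations `ℤ² → A`, with the product topology. -/
abbrev Config (A : Type u) : Type u := ℤ × ℤ → A

/-- The shift action: `(g x)(h) = x(h - g)`. -/
def shift {A : Type u} (g : ℤ × ℤ) (x : Config A) : Config A := fun h => x (h - g)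

/-- A subshift: a closed set of configurations which is invariant under all shifts. -/
structure IsSubshift {A : Type u} [TopologicalSpace A] (W : Set (Config A)) : Prop where
  isClosed : IsClosed W
  shift_mem : ∀ g : ℤ × ℤ, ∀ x ∈ W, shift g x ∈ W

/-- A pattern: a function on a finite subset of `ℤ²`. -/
structure Pattern (A : Type u) where
  supp : Finset (ℤ × ℤ)
  val : supp → A

/-- The pattern `w` appears in `x` if some translate of `w` is a restriction of `x`. -/
def Pattern.AppearsIn {A : Type u} (w : Pattern A) (x : Config A) : Prop :=
  ∃ g : ℤ × ℤ, ∀ s : w.supp, x (s.1 + g) = w.val s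

/-- `W` carries a fully supported measure: a shift-invariant Borel probability measure
concentrated on `W` and charging every nonempty relatively open subset of `W`. -/
def HasFullySupportedMeasure {A : Type u} [TopologicalSpace A] (W : Set (Config A)) : Prop :=
  letI : MeasurableSpace (Config A) := borel (Config A)
  ∃ μ : Measure (Config A), IsProbabilityMeasure μ ∧
    (∀ g : ℤ × ℤ, μ.map (shift g) = μ) ∧
    μ Wᶜ = 0 ∧
    ∀ U : Set (Config A), IsOpen U → (U ∩ W).Nonempty → 0 < μ U

/-! ### Entropy of covers, topological entropy, completely positive entropy -/

/-- The common refinement of the covers `g⁻¹ 𝒰`, for `g ∈ [0,n)²`. -/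
def coverJoin {Z : Type u} (T : ℤ × ℤ → Z → Z) (𝒰 : Set (Set Z)) (n : ℕ) : Set (Set Z) :=
  {P | ∃ c : ℤ × ℤ → Set Z, (∀ g, c g ∈ 𝒰) ∧
    P = {z | ∀ g ∈ Set.Ico (0 : ℤ) n ×ˢ Set.Ico (0 : ℤ) n, T g z ∈ c g}}

/-- The smallest cardinality of a subfamily of `𝒱` which covers `X`. -/
def minCover {Z : Type u} (X : Set Z) (𝒱 : Set (Set Z)) : ℕ :=
  sInf {k | ∃ F : Finset (Set Z), (F : Set (Set Z)) ⊆ 𝒱 ∧ X ⊆ ⋃₀ (F : Set (Set Z)) ∧ F.card = k}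

/-- The entropy `h(X, 𝒰)` of `X`, under the `ℤ²`-action `T`, relative to the cover `𝒰` of `X`.
For an open cover of a compact invariant set the limit superior is a limit. -/
def coverEntropy {Z : Type u} (T : ℤ × ℤ → Z → Z) (X : Set Z) (𝒰 : Set (Set Z)) : EReal :=
  limsup (fun n : ℕ => ((Real.log (minCover X (coverJoin T 𝒰 n)) / (n : ℝ) ^ 2 : ℝ) : EReal)) atTop

/-- The topological entropy of a `ℤ²`-action: the supremum of the entropies of open covers. -/
def topEntropy (Y : Type u) [TopologicalSpace Y] [AddAction (ℤ × ℤ) Y] : EReal :=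
  ⨆ 𝒰 : {𝒰 : Set (Set Y) // (∀ U ∈ 𝒰, IsOpen U) ∧ ⋃₀ 𝒰 = Set.univ},
    coverEntropy (fun (g : ℤ × ℤ) (y : Y) => g +ᵥ y) Set.univ 𝒰.1

/-- Topological completely positive entropy: every factor (a compact metrizable space with an
action of `ℤ²` by homeomorphisms, and a continuous equivariant surjection onto it) with more than
one point has positive topological entropy. A factor is homeomorphic to a quotient of `X`, so
nothing is lost by taking it in the universe of `X`. -/
def HasTCPE {A : Type u} [TopologicalSpace A] (X : Set (Config A)) : Prop :=
  ∀ (Y : Type u) [TopologicalSpace Y] [CompactSpace Y] [TopologicalSpace.MetrizableSpace Y]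
    [AddAction (ℤ × ℤ) Y] [ContinuousConstVAdd (ℤ × ℤ) Y] (π : X → Y),
    Continuous π → Function.Surjective π →
    (∀ (g : ℤ × ℤ) (x x' : X), x'.1 = shift g x.1 → π x' = g +ᵥ π x) →
    Nontrivial Y → 0 < topEntropy Y

/-- Entropy pairs of a subshift `X`: distinct points `x, y` such that `h(X, {Kᶜ, K'ᶜ}) > 0` for
all disjoint closed neighbourhoods `K` of `x` and `K'` of `y`. -/
def IsEntropyPair {A : Type u} [TopologicalSpace A] (X : Set (Config A)) (x y : Config A) : Prop :=
  x ∈ X ∧ y ∈ X ∧ x ≠ y ∧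
    ∀ K K' : Set (Config A), IsClosed K → IsClosed K' → K ∈ 𝓝[X] x → K' ∈ 𝓝[X] y →
      Disjoint K K' → 0 < coverEntropy shift X {Kᶜ, K'ᶜ}

/-! ### The two hierarchies of relations -/

/-- Transfinite iteration indexed from `1`: the level `1` is `base`, the level `α + 1` is `step` of
the level `α` for `α ≥ 1`, and limit levels are unions. (The level `0` is unused; by convention it
is `base` as well.) -/
def levels {P : Type u} (base : Set P) (step : Set P → Set P) (α : Ordinal.{0}) : Set P :=
  Ordinal.limitRecOn (motive := fun _ => Set P) α base
    (fun β S => open Classical in if β = 0 then base else step S)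
    (fun l _ S => ⋃ (β : Ordinal.{0}) (hβ : β < l), S β hβ)

/-- The transitive closure of a relation. -/
def transClosure {Z : Type u} (R : Set (Z × Z)) : Set (Z × Z) :=
  {p | Relation.TransGen (fun a b => (a, b) ∈ R) p.1 p.2}

/-- The transitive, symmetric closure of a relation. -/
def transSymmClosure {Z : Type u} (R : Set (Z × Z)) : Set (Z × Z) :=
  {p | Relation.TransGen (Relation.SymmGen fun a b => (a, b) ∈ R) p.1 p.2}

/-- `R` is an equivalence relation on the set `X`. -/
def IsEquivOn {Z : Type u} (X : Set Z) (R : Set (Z × Z)) : Prop :=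
  (∀ x ∈ X, (x, x) ∈ R) ∧ (∀ x y, (x, y) ∈ R → (y, x) ∈ R) ∧
    ∀ x y z, (x, y) ∈ R → (y, z) ∈ R → (x, z) ∈ R

/-- The set `E₁` of entropy-or-equal pairs of `X`. -/
def entropyOrEqual {A : Type u} [TopologicalSpace A] (X : Set (Config A)) :
    Set (Config A × Config A) :=
  {p | p.1 ∈ X ∧ p.2 ∈ X ∧ (p.1 = p.2 ∨ IsEntropyPair X p.1 p.2)}

/-- The successor step of the hierarchy `E`. -/
def entropyStep {A : Type u} [TopologicalSpace A] (X : Set (Config A))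
    (R : Set (Config A × Config A)) : Set (Config A × Config A) :=
  open Classical in
  if ¬ IsClosed R then closure R
  else if ¬ IsEquivOn X R then transSymmClosure R
  else R

/-- The relations `E_α` on `X`, for `1 ≤ α`. -/
def E {A : Type u} [TopologicalSpace A] (X : Set (Config A)) (α : Ordinal.{0}) :
    Set (Config A × Config A) :=
  levels (entropyOrEqual X) (entropyStep X) α

/-- The TCPE rank of `X`: the least `α ∈ [1, ω₁)` with `E_α = X²` (`0` if there is none). -/
def tcpeRank {A : Type u} [TopologicalSpace A] (X : Set (Config A)) : Ordinal.{0} :=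
  sInf {α | 1 ≤ α ∧ α < Ordinal.omega 1 ∧ E X α = X ×ˢ X}

/-- The set `T₁` of transitivity pairs of `W`: any two patterns appearing in `x` and in `x'`,
respectively, coexist in some point of `W`. -/
def transitivityPairs {A : Type u} (W : Set (Config A)) : Set (Config A × Config A) :=
  {p | p.1 ∈ W ∧ p.2 ∈ W ∧ ∀ v v' : Pattern A, v.AppearsIn p.1 → v'.AppearsIn p.2 →
    ∃ z ∈ W, v.AppearsIn z ∧ v'.AppearsIn z}

/-- The successor step of the hierarchy `T`. -/
def transitivityStep {A : Type u} [TopologicalSpace A]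
    (R : Set (Config A × Config A)) : Set (Config A × Config A) :=
  open Classical in if IsClosed R then transClosure R else closure R

/-- The relations `T_α` on `W`, for `1 ≤ α`. -/
def T {A : Type u} [TopologicalSpace A] (W : Set (Config A)) (α : Ordinal.{0}) :
    Set (Config A × Config A) :=
  levels (transitivityPairs W) transitivityStep α

/-- `W` is generalized transitive: `T_α = W²` for some `α ∈ [1, ω₁)`. -/
def IsGeneralizedTransitive {A : Type u} [TopologicalSpace A] (W : Set (Config A)) : Prop :=
  ∃ α : Ordinal.{0}, 1 ≤ α ∧ α < Ordinal.omega 1 ∧ T W α = W ×ˢ W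

/-- The generalized transitivity rank of `W`: the least `α ∈ [1, ω₁)` with `T_α = W²`
(`0` if there is none). -/
def transitivityRank {A : Type u} [TopologicalSpace A] (W : Set (Config A)) : Ordinal.{0} :=
  sInf {α | 1 ≤ α ∧ α < Ordinal.omega 1 ∧ T W α = W ×ˢ W}

/-! ### Printing a configuration on fabric -/

/-- A family of ribbons. Read horizontally, the `i`-th ribbon is the set of sites `(n, R i n)`.
Ribbons are paths that make steps of height `-1`, `0` or `1`, never twice in a row in the same
direction up or down, and consecutive ribbons are at distance `2`, `3` or `4` everywhere; so the
perfectly straight family `R i n = 3 * i` can be wiggled freely. -/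
structure IsRibbonFamily (R : ℤ → ℤ → ℤ) : Prop where
  step_one : ∀ i n, |R i (n + 1) - R i n| ≤ 1
  step_two : ∀ i n, |R i (n + 2) - R i n| ≤ 1
  two_le_gap : ∀ i n, 2 ≤ R (i + 1) n - R i n
  gap_le_four : ∀ i n, R (i + 1) n - R i n ≤ 4

/-- The alphabet of the fabric. The first coordinate of a symbol tells whether a horizontal ribbon
passes through the site, and its direction there; the second coordinate does the same for vertical
ribbons; the third coordinate holds a letter of `A` at the crossings of the ribbons. -/
def Symbol (A : Type u) : Type u := Option SignType × Option SignType × Option A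

instance (A : Type u) : TopologicalSpace (Symbol A) := ⊥

instance (A : Type u) : DiscreteTopology (Symbol A) := ⟨rfl⟩

instance (A : Type u) [Finite A] : Finite (Symbol A) :=
  inferInstanceAs (Finite (Option SignType × Option SignType × Option A))

/-- The horizontal ribbon `i` (through the sites `(n, H i n)`) crosses the vertical ribbon `j`
(through the sites `(V j m, m)`) at the column `n`: the site `(n, H i n)` is the last one of the
horizontal ribbon that does not lie to the right of the vertical ribbon. Since ribbons climb at
most one step in two, every horizontal ribbon crosses every vertical one exactly once. -/
def CrossesAt (H V : ℤ → ℤ → ℤ) (i j n : ℤ) : Prop :=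
  n ≤ V j (H i n) ∧ V j (H i (n + 1)) < n + 1

/-- `y` is the configuration `x` printed on the fabric with horizontal ribbons `H` and vertical
ribbons `V`: the ribbons and their directions are recorded in the first two coordinates of `y`,
and the letter `x (j, i)` is written where the horizontal ribbon `i` crosses the vertical
ribbon `j`. -/
structure IsWeave {A : Type u} (H V : ℤ → ℤ → ℤ) (x : Config A) (y : Config (Symbol A)) :
    Prop where
  horizontal : ∀ (n m : ℤ) (d : SignType),
    (y (n, m)).1 = some d ↔ ∃ i, m = H i n ∧ (d : ℤ) = H i (n + 1) - H i n
  vertical : ∀ (n m : ℤ) (d : SignType),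
    (y (n, m)).2.1 = some d ↔ ∃ j, n = V j m ∧ (d : ℤ) = V j (m + 1) - V j m
  letter : ∀ (n m : ℤ) (a : A),
    (y (n, m)).2.2 = some a ↔ ∃ i j, m = H i n ∧ CrossesAt H V i j n ∧ a = x (j, i)

/-- The fabric map: `f(x)` is the set of all the ways to print `x` on fabric. -/
def fabric {A : Type u} (x : Config A) : Set (Config (Symbol A)) :=
  {y | ∃ H V : ℤ → ℤ → ℤ, IsRibbonFamily H ∧ IsRibbonFamily V ∧ IsWeave H V x y}

/-- `f(W)`, the union of the sets `f(x)` for `x ∈ W`. -/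
def fabricSet {A : Type u} (W : Set (Config A)) : Set (Config (Symbol A)) :=
  ⋃ x ∈ W, fabric x

/-- `f(R)`, the union of the sets `f(x) × f(x')` for `(x, x') ∈ R`. -/
def fabricRel {A : Type u} (R : Set (Config A × Config A)) :
    Set (Config (Symbol A) × Config (Symbol A)) :=
  ⋃ p ∈ R, fabric p.1 ×ˢ fabric p.2

end Fabric

end

noncomputable section

namespace Fabric

universe u v

/-! ### Ribbon families -/

section Ribbons

variable {R H V H' V' : ℤ → ℤ → ℤ}

/-! The ribbons can be read off a fabric up to relabelling, so a fabric determines the configuration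
printed on it exactly up to a shift (`exists_eq_shift_of_mem_fabric`). Relations on `W` invariant
under independent shifts of the two points are therefore encoded faithfully by `fabricRel`
(`fabricRel_inj`). This encoding commutes with closures, because normalized weaves form a compact
space and printing on a fixed fabric is continuous, and it commutes with transitive closures. Hence,
once `f(T₁) = E₁` is known, the two hierarchies match level by level (`fabricRel_T`).

For `E₁ ⊆ f(T₁)`: if `v` and `v'` never coexist in a point of `W`, fabrics carrying `v` and fabrics
carrying `v'` lie in different orbits. Every orbit then misses one of two suitable neighbourhoods,
and two sets cover at every scale, so there is no entropy.

For `f(T₁) ⊆ E₁`: large central patterns of `x` and `x'` coexist in a point of `W`, at some relative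
offset `k`. The open set of points showing both at offset `k` has positive measure, so some `z ∈ W`
visits it at a positive proportion of the sites of a sparse lattice. Ribbons have enough slack to be
deformed independently in each cell of a coarse grid (`exists_truncate`,
`exists_isRibbonFamily_glue`). Pulling in the ribbons labelled near the cell's centre, or those
displaced by `k`, shows a piece of `y` or of `y'` there, always printing the same `z`. These free
binary choices, of positive density, give entropy.

As to TCPE, the kernel of a zero-entropy factor is a closed equivalence relation containing the
entropy pairs, hence every `E_α`; so `E_α = X²` forces TCPE. Conversely, second countability makes
the hierarchy `T` reach a closed transitive relation before `ω₁`. Its image is a closed equivalence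
relation with shift-invariant classes, so the quotient has trivial action and no entropy, and TCPE
leaves a single class. -/

theorem IsRibbonFamily.strictMono (hR : IsRibbonFamily R) (n : ℤ) : StrictMono fun i => R i n :=
  strictMono_int_of_lt_succ fun i => by have := hR.two_le_gap i n; omega

theorem IsRibbonFamily.abs_index_le_nat (hR : IsRibbonFamily R) (n i : ℤ) (k : ℕ) :
    |R (i + k) n - R i n - 3 * k| ≤ k := by
  induction k with
  | zero => simp
  | succ k ih =>
    have h1 := hR.two_le_gap (i + k) n
    have h2 := hR.gap_le_four (i + k) n
    rw [abs_le] at *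
    push_cast
    rw [← add_assoc]
    omega

theorem IsRibbonFamily.abs_index_le (hR : IsRibbonFamily R) (n i : ℤ) :
    |R i n - R 0 n - 3 * i| ≤ |i| := by
  rcases Int.le_total 0 i with h | h
  · have := hR.abs_index_le_nat n 0 i.toNat
    rw [Int.toNat_of_nonneg h, zero_add] at this
    rwa [abs_of_nonneg h]
  · have := hR.abs_index_le_nat n i (-i).toNat
    rw [Int.toNat_of_nonneg (by omega), add_neg_cancel] at this
    rw [abs_of_nonpos h]
    rw [abs_le] at *
    omega

/-- Two consecutive steps change the height by at most one, so a ribbon has slope at most 1/2 up to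
rounding. This is what forces horizontal and vertical ribbons to cross. -/
theorem IsRibbonFamily.two_mul_abs_sub_le_nat (hR : IsRibbonFamily R) (i n : ℤ) (k : ℕ) :
    2 * |R i (n + k) - R i n| ≤ k + 1 := by
  induction k using Nat.twoStepInduction with
  | zero => simp
  | one => have := hR.step_one i n; push_cast; omega
  | more k ih _ =>
    have h := hR.step_two i (n + k)
    have h3 := abs_sub_le (R i (n + k + 2)) (R i (n + k)) (R i n)
    push_cast
    rw [← add_assoc]
    omega

theorem IsRibbonFamily.two_mul_abs_sub_le (hR : IsRibbonFamily R) (i n m : ℤ) :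
    2 * |R i n - R i m| ≤ |n - m| + 1 := by
  rcases Int.le_total m n with h | h
  · have := hR.two_mul_abs_sub_le_nat i m (n - m).toNat
    rw [Int.toNat_of_nonneg (by omega)] at this
    rw [abs_of_nonneg (show 0 ≤ n - m by omega)]
    simpa using this
  · have := hR.two_mul_abs_sub_le_nat i n (m - n).toNat
    rw [Int.toNat_of_nonneg (by omega)] at this
    rw [abs_of_nonpos (show n - m ≤ 0 by omega), abs_sub_comm]
    simpa using this

theorem IsRibbonFamily.abs_sub_le (hR : IsRibbonFamily R) (i n m : ℤ) :
    |R i n - R i m| ≤ |n - m| := by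
  have := hR.two_mul_abs_sub_le i n m
  rcases eq_or_ne n m with rfl | h
  · simp
  · have := abs_pos.2 (sub_ne_zero.2 h)
    omega

/-- A ribbon passing near the origin has a small index. -/
theorem IsRibbonFamily.two_mul_abs_le (hR : IsRibbonFamily R) (i n : ℤ) :
    2 * |i| ≤ |R i n| + |n| + |R 0 0| := by
  have h1 := hR.abs_index_le n i
  have h2 := hR.abs_sub_le 0 n 0
  rw [sub_zero] at h2
  grind

theorem IsRibbonFamily.abs_le (hR : IsRibbonFamily R) (i n : ℤ) :
    |R i n| ≤ 4 * |i| + |n| + |R 0 0| := by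
  have h1 := hR.abs_index_le n i
  have h2 := hR.abs_sub_le 0 n 0
  rw [sub_zero] at h2
  grind

/-- The result of relabelling and translating a ribbon family. -/
theorem IsRibbonFamily.translate (hR : IsRibbonFamily R) (k g c : ℤ) :
    IsRibbonFamily fun i n => R (i + k) (n + g) - c where
  step_one i n := by
    have := hR.step_one (i + k) (n + g)
    rw [show n + 1 + g = n + g + 1 by ring]
    simpa using this
  step_two i n := by
    have := hR.step_two (i + k) (n + g)
    rw [show n + 2 + g = n + g + 2 by ring]
    simpa using this
  two_le_gap i n := by
    have := hR.two_le_gap (i + k) (n + g)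
    rw [show i + 1 + k = i + k + 1 by ring]
    omega
  gap_le_four i n := by
    have := hR.gap_le_four (i + k) (n + g)
    rw [show i + 1 + k = i + k + 1 by ring]
    omega

/-- Every ribbon family has a relabelling whose ribbon number `0` passes close to the origin. -/
theorem IsRibbonFamily.exists_index (hR : IsRibbonFamily R) : ∃ k, R k 0 ∈ Icc (-4 : ℤ) 0 := by
  obtain ⟨k, hk, hmax⟩ := Int.exists_greatest_of_bdd (P := fun i => R i 0 ≤ 0)
    ⟨|R 0 0|, fun i hi => by have := hR.abs_index_le 0 i; grind⟩
    ⟨-|R 0 0|, by have := hR.abs_index_le 0 (-|R 0 0|); grind⟩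
  refine ⟨k, ?_, hk⟩
  have h1 := hR.gap_le_four k 0
  by_contra h
  have := hmax (k + 1) (by simp only [not_le] at h; omega)
  omega

theorem exists_signType_eq {a : ℤ} (ha : |a| ≤ 1) : ∃ d : SignType, (d : ℤ) = a := by
  rw [_root_.abs_le] at ha
  obtain h | h | h : a = -1 ∨ a = 0 ∨ a = 1 := by omega
  · exact ⟨-1, by simp [h]⟩
  · exact ⟨0, by simp [h]⟩
  · exact ⟨1, by simp [h]⟩

theorem signType_intCast_injective : Function.Injective ((↑) : SignType → ℤ) := by
  intro a b h
  cases a <;> cases b <;> simp_all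

/-- Every horizontal ribbon crosses every vertical one. -/
theorem exists_crossesAt (hH : IsRibbonFamily H) (hV : IsRibbonFamily V) (i j : ℤ) :
    ∃ n, CrossesAt H V i j n := by
  -- The composite `n ↦ V j (H i n)` has slope at most 1/2, so `n ≤ V j (H i n)` holds far to the
  -- left and fails far to the right; the last column where it holds is the crossing.
  have key : ∀ n, 2 * |V j (H i n) - V j (H i 0)| ≤ |n| + 1 := fun n => by
    have h1 := hV.abs_sub_le j (H i n) (H i 0)
    have h2 := hH.two_mul_abs_sub_le i n 0
    rw [sub_zero] at h2
    omega
  obtain ⟨n, hn, hmax⟩ := Int.exists_greatest_of_bdd (P := fun n => n ≤ V j (H i n))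
    ⟨2 * |V j (H i 0)| + 1, fun n hn => by
      have := key n
      rcases abs_cases n with h | h <;> rcases abs_cases (V j (H i n) - V j (H i 0)) with h' | h' <;>
        rcases abs_cases (V j (H i 0)) with h'' | h'' <;> omega⟩
    ⟨-(2 * |V j (H i 0)| + 1), by
      have := key (-(2 * |V j (H i 0)| + 1))
      generalize hn : -(2 * |V j (H i 0)| + 1) = n at *
      rcases abs_cases n with h | h <;> rcases abs_cases (V j (H i n) - V j (H i 0)) with h' | h' <;>
        rcases abs_cases (V j (H i 0)) with h'' | h'' <;> omega⟩
  refine ⟨n, hn, ?_⟩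
  by_contra h
  have := hmax (n + 1) (by omega)
  omega

theorem CrossesAt.mem_Icc (hH : IsRibbonFamily H) (hV : IsRibbonFamily V) {i j n : ℤ}
    (h : CrossesAt H V i j n) : V j (H i n) ∈ Icc n (n + 1) := by
  refine ⟨h.1, ?_⟩
  have h1 := hH.step_one i n
  have h2 := hV.abs_sub_le j (H i (n + 1)) (H i n)
  have := h.2
  grind

/-- A crossing at column `n` pins the vertical ribbon to one of two adjacent columns, whereas
distinct vertical ribbons are at least 2 apart. -/
theorem CrossesAt.index_unique (hH : IsRibbonFamily H) (hV : IsRibbonFamily V) {i j j' n : ℤ}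
    (h : CrossesAt H V i j n) (h' : CrossesAt H V i j' n) : j = j' := by
  wlog hlt : j < j' generalizing j j'
  · by_contra hne
    exact hne (this h' h (by omega)).symm
  have h1 := (h.mem_Icc hH hV)
  have h2 := (h'.mem_Icc hH hV)
  have h3 := (hV.strictMono (H i n)).monotone (show j + 1 ≤ j' by omega)
  have h4 := hV.two_le_gap j (H i n)
  have := h1.1
  have := h2.2
  omega

end Ribbons

/-! ### Weaves -/

section Weaves

variable {A : Type u} {H V H' V' : ℤ → ℤ → ℤ} {x x' : Config A} {y y' : Config (Symbol A)}

theorem exists_option_eq_some_iff {α : Type*} {P : α → Prop} (hP : ∀ a b, P a → P b → a = b) :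
    ∃ o : Option α, ∀ a, o = some a ↔ P a := by
  by_cases h : ∃ a, P a
  · obtain ⟨a, ha⟩ := h
    exact ⟨some a, fun b => ⟨fun hb => by obtain rfl := Option.some.inj hb; exact ha,
      fun hb => by rw [hP a b ha hb]⟩⟩
  · exact ⟨none, fun b => ⟨fun hb => by simp at hb, fun hb => (h ⟨b, hb⟩).elim⟩⟩

theorem exists_isWeave (hH : IsRibbonFamily H) (hV : IsRibbonFamily V) (x : Config A) :
    ∃ y, IsWeave H V x y := by
  have key : ∀ p : ℤ × ℤ, ∃ s : Symbol A,
      (∀ d : SignType, s.1 = some d ↔ ∃ i, p.2 = H i p.1 ∧ (d : ℤ) = H i (p.1 + 1) - H i p.1) ∧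
      (∀ d : SignType, s.2.1 = some d ↔ ∃ j, p.1 = V j p.2 ∧ (d : ℤ) = V j (p.2 + 1) - V j p.2) ∧
      (∀ a : A, s.2.2 = some a ↔ ∃ i j, p.2 = H i p.1 ∧ CrossesAt H V i j p.1 ∧ a = x (j, i)) := by
    rintro ⟨n, m⟩
    obtain ⟨o₁, h₁⟩ := exists_option_eq_some_iff (P := fun d : SignType =>
      ∃ i, m = H i n ∧ (d : ℤ) = H i (n + 1) - H i n) (by
        rintro a b ⟨i, hi, ha⟩ ⟨i', hi', hb⟩
        obtain rfl : i = i' := (hH.strictMono n).injective (hi.symm.trans hi')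
        exact signType_intCast_injective (ha.trans hb.symm))
    obtain ⟨o₂, h₂⟩ := exists_option_eq_some_iff (P := fun d : SignType =>
      ∃ j, n = V j m ∧ (d : ℤ) = V j (m + 1) - V j m) (by
        rintro a b ⟨i, hi, ha⟩ ⟨i', hi', hb⟩
        obtain rfl : i = i' := (hV.strictMono m).injective (hi.symm.trans hi')
        exact signType_intCast_injective (ha.trans hb.symm))
    obtain ⟨o₃, h₃⟩ := exists_option_eq_some_iff (P := fun a : A =>
      ∃ i j, m = H i n ∧ CrossesAt H V i j n ∧ a = x (j, i)) (by
        rintro a b ⟨i, j, hi, hc, ha⟩ ⟨i', j', hi', hc', hb⟩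
        obtain rfl : i = i' := (hH.strictMono n).injective (hi.symm.trans hi')
        obtain rfl := hc.index_unique hH hV hc'
        exact ha.trans hb.symm)
    exact ⟨(o₁, o₂, o₃), h₁, h₂, h₃⟩
  choose y hy using key
  exact ⟨y, fun n m => (hy (n, m)).1, fun n m => (hy (n, m)).2.1, fun n m => (hy (n, m)).2.2⟩

theorem fabric_nonempty (x : Config A) : (fabric x).Nonempty := by
  have h : IsRibbonFamily fun i _ => 3 * i :=
    ⟨by simp, by simp, fun i _ => by ring_nf; norm_num, fun i _ => by ring_nf; norm_num⟩
  obtain ⟨y, hy⟩ := exists_isWeave h h x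
  exact ⟨y, _, _, h, h, hy⟩

/-- Relabelling the ribbons by `k` and translating the plane by `g`. -/
theorem IsWeave.translate (h : IsWeave H V x y) (g k : ℤ × ℤ) :
    IsWeave (fun i n => H (i + k.2) (n + g.1) - g.2) (fun j m => V (j + k.1) (m + g.2) - g.1)
      (fun p => x (p + k)) (fun p => y (p + g)) where
  horizontal n m d := by
    rw [show (n, m) + g = (n + g.1, m + g.2) from rfl, h.horizontal, add_right_comm n 1]
    constructor
    · rintro ⟨i, hi, hd⟩
      exact ⟨i - k.2, by rw [sub_add_cancel]; omega, by rw [sub_add_cancel]; omega⟩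
    · rintro ⟨i, hi, hd⟩
      exact ⟨i + k.2, by omega, by omega⟩
  vertical n m d := by
    rw [show (n, m) + g = (n + g.1, m + g.2) from rfl, h.vertical, add_right_comm m 1]
    constructor
    · rintro ⟨i, hi, hd⟩
      exact ⟨i - k.1, by rw [sub_add_cancel]; omega, by rw [sub_add_cancel]; omega⟩
    · rintro ⟨i, hi, hd⟩
      exact ⟨i + k.1, by omega, by omega⟩
  letter n m a := by
    rw [show (n, m) + g = (n + g.1, m + g.2) from rfl, h.letter]
    simp only [CrossesAt, add_right_comm n 1, sub_add_cancel, Prod.add_def]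
    constructor
    · rintro ⟨i, j, hi, ⟨hc, hc'⟩, ha⟩
      refine ⟨i - k.2, j - k.1, ?_, ⟨?_, ?_⟩, ?_⟩ <;> simp only [sub_add_cancel]
      exacts [by omega, by omega, by omega, ha]
    · rintro ⟨i, j, hi, ⟨hc, hc'⟩, ha⟩
      exact ⟨i + k.2, j + k.1, by omega, ⟨by omega, by omega⟩, ha⟩

/-! ### The configuration printed on a fabric is determined up to a shift -/

/-- The two enumerations differ by an order automorphism of `ℤ`, and these are the translations. -/
theorem exists_add_of_range_eq {a b : ℤ → ℤ} (ha : StrictMono a) (hb : StrictMono b)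
    (h : range a = range b) : ∃ k, ∀ i, b i = a (i + k) := by
  have h1 : ∀ i, ∃ l, a l = b i := fun i => by
    have : b i ∈ range a := h ▸ mem_range_self i
    exact this
  choose φ hφ using h1
  have hmono : StrictMono φ := fun i j hij => by
    rw [← ha.lt_iff_lt, hφ, hφ]
    exact hb hij
  have hsurj : ∀ l, ∃ i, φ i = l := fun l => by
    obtain ⟨i, hi⟩ : a l ∈ range b := h ▸ mem_range_self l
    exact ⟨i, ha.injective ((hφ i).trans hi)⟩
  have hstep : ∀ i, φ (i + 1) = φ i + 1 := fun i => by
    have h2 := hmono (show i < i + 1 by omega)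
    obtain ⟨j, hj⟩ := hsurj (φ i + 1)
    by_contra hne
    have h3 : i < j := hmono.lt_iff_lt.1 (by omega)
    have h4 : j < i + 1 := hmono.lt_iff_lt.1 (by omega)
    omega
  have hlin : ∀ i, φ i = i + φ 0 := fun i => by
    induction i using Int.induction_on with
    | zero => simp
    | succ i ih => rw [hstep, ih]; ring
    | pred i ih =>
      have := hstep (-(i : ℤ) - 1)
      rw [sub_add_cancel, ih] at this
      omega
  exact ⟨φ 0, fun i => by rw [← hlin, hφ]⟩

theorem eq_of_forall_succ_eq {α : Type*} {k : ℤ → α} (h : ∀ n, k (n + 1) = k n) (n : ℤ) :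
    k n = k 0 := by
  induction n using Int.induction_on with
  | zero => rfl
  | succ i ih => rw [h, ih]
  | pred i ih => rw [← ih, ← h, sub_add_cancel]

/-- Two ribbon families that pass through the same sites in the same directions are equal up to
relabelling. -/
theorem IsRibbonFamily.exists_eq_add {R R' : ℤ → ℤ → ℤ} (hR : IsRibbonFamily R)
    (hR' : IsRibbonFamily R')
    (h : ∀ (n m : ℤ) (d : SignType), (∃ i, m = R i n ∧ (d : ℤ) = R i (n + 1) - R i n) ↔
      ∃ i, m = R' i n ∧ (d : ℤ) = R' i (n + 1) - R' i n) :
    ∃ k, ∀ i n, R' i n = R (i + k) n := by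
  have hk : ∀ n, ∃ k, ∀ i, R' i n = R (i + k) n := fun n => by
    refine exists_add_of_range_eq (hR.strictMono n) (hR'.strictMono n) ?_
    ext m
    constructor
    · rintro ⟨i, rfl⟩
      obtain ⟨d, hd⟩ := exists_signType_eq (hR.step_one i n)
      obtain ⟨i', hi', -⟩ := (h n (R i n) d).1 ⟨i, rfl, hd⟩
      exact ⟨i', hi'.symm⟩
    · rintro ⟨i, rfl⟩
      obtain ⟨d, hd⟩ := exists_signType_eq (hR'.step_one i n)
      obtain ⟨i', hi', -⟩ := (h n (R' i n) d).2 ⟨i, rfl, hd⟩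
      exact ⟨i', hi'.symm⟩
  choose k hk using hk
  -- Position and direction at column `n` determine the position at column `n + 1`, so following one
  -- ribbon shows that the relabelling does not depend on the column.
  have hconst : ∀ n, k (n + 1) = k n := fun n => by
    obtain ⟨d, hd⟩ := exists_signType_eq (hR'.step_one 0 n)
    obtain ⟨i, hi, hd'⟩ := (h n (R' 0 n) d).2 ⟨0, rfl, hd⟩
    have h1 := hk n 0
    have h2 := hk (n + 1) 0
    have h3 : 0 + k n = i := (hR.strictMono n).injective (h1.symm.trans hi)
    have h4 : 0 + k (n + 1) = i := (hR.strictMono (n + 1)).injective (by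
      refine Eq.trans h2.symm ?_
      omega)
    omega
  exact ⟨k 0, fun i n => by rw [hk n, eq_of_forall_succ_eq hconst]⟩

theorem IsWeave.exists_translate_eq (hH : IsRibbonFamily H) (hV : IsRibbonFamily V)
    (hH' : IsRibbonFamily H') (hV' : IsRibbonFamily V') (h : IsWeave H V x y)
    (h' : IsWeave H' V' x' y) : ∃ k : ℤ × ℤ, ∀ p, x' p = x (p + k) := by
  obtain ⟨k₂, hk₂⟩ := hH.exists_eq_add hH' fun n m d => by rw [← h.horizontal, h'.horizontal]
  obtain ⟨k₁, hk₁⟩ := hV.exists_eq_add hV' fun m n d => by rw [← h.vertical, h'.vertical]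
  refine ⟨(k₁, k₂), fun ⟨j, i⟩ => ?_⟩
  obtain ⟨n, hn⟩ := exists_crossesAt hH' hV' i j
  -- The letter written at one crossing is read through both weaves. Its height identifies the
  -- horizontal ribbon, and then its column identifies the vertical one.
  obtain ⟨i₂, j₂, hi, hc, hx⟩ := (h.letter n _ _).1 ((h'.letter n _ _).2 ⟨i, j, rfl, hn, rfl⟩)
  obtain rfl : i + k₂ = i₂ := (hH.strictMono n).injective ((hk₂ i n).symm.trans hi)
  have hc' : CrossesAt H V (i + k₂) (j + k₁) n := by
    simpa only [CrossesAt, hk₁, hk₂] using hn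
  rw [hx, hc.index_unique hH hV hc']
  rfl

/-! ### The fabric is locally determined -/

/-- By `two_mul_abs_le` only ribbons of bounded index come near the origin; the terms `|H 0 0|` and
`|V 0 0|` account for the position of the ribbons numbered `0`. One implication suffices, since the
roles of the weaves can be exchanged. -/
theorem IsWeave.eq_some_of_agree (hH : IsRibbonFamily H) (hV : IsRibbonFamily V)
    (h : IsWeave H V x y) (h' : IsWeave H' V' x' y') {N I : ℤ}
    (hI : 2 * N + |H 0 0| + |V 0 0| + 4 ≤ I)
    (hHH : ∀ i n, |i| ≤ I → |n| ≤ I → H i n = H' i n)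
    (hVV : ∀ j m, |j| ≤ I → |m| ≤ I → V j m = V' j m)
    (hxx : ∀ j i, |j| ≤ I → |i| ≤ I → x (j, i) = x' (j, i)) {n m : ℤ} (hn : |n| ≤ N)
    (hm : |m| ≤ N) :
    (∀ d, (y (n, m)).1 = some d → (y' (n, m)).1 = some d) ∧
    (∀ d, (y (n, m)).2.1 = some d → (y' (n, m)).2.1 = some d) ∧
    (∀ a, (y (n, m)).2.2 = some a → (y' (n, m)).2.2 = some a) := by
  have hH0 := abs_nonneg (H 0 0)
  have hV0 := abs_nonneg (V 0 0)
  have hn0 := abs_nonneg n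
  have hn1 : |n + 1| ≤ N + 1 := (abs_add_le n 1).trans (by simpa using hn)
  have hm1 : |m + 1| ≤ N + 1 := (abs_add_le m 1).trans (by simpa using hm)
  have key : ∀ i, |H i n| ≤ N → H i n = H' i n ∧ H i (n + 1) = H' i (n + 1) ∧ |i| ≤ I :=
      fun i hi => by
    have := hH.two_mul_abs_le i n
    exact ⟨hHH i n (by omega) (by omega), hHH i (n + 1) (by omega) (by omega), by omega⟩
  have key' : ∀ j, |V j m| ≤ N + 1 →
      |j| ≤ I ∧ ∀ l, |l| ≤ N + 1 → V j l = V' j l := fun j hj => by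
    have := hV.two_mul_abs_le j m
    exact ⟨by omega, fun l hl => hVV j l (by omega) (by omega)⟩
  refine ⟨fun d hd => ?_, fun d hd => ?_, fun a ha => ?_⟩
  · obtain ⟨i, rfl, hd'⟩ := (h.horizontal _ _ _).1 hd
    obtain ⟨h1, h2, -⟩ := key i hm
    exact (h'.horizontal _ _ _).2 ⟨i, h1, by rw [hd', h1, h2]⟩
  · obtain ⟨j, rfl, hd'⟩ := (h.vertical _ _ _).1 hd
    obtain ⟨-, h1⟩ := key' j (by omega)
    exact (h'.vertical _ _ _).2 ⟨j, h1 m (by omega), by rw [hd', h1 m (by omega), h1 _ hm1]⟩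
  · obtain ⟨i, j, rfl, hc, ha'⟩ := (h.letter _ _ _).1 ha
    obtain ⟨h1, h2, hi⟩ := key i hm
    have hmem := hc.mem_Icc hH hV
    have hb : |V j (H i n)| ≤ N + 1 := by
      rw [_root_.abs_le] at *
      have := hmem.1
      have := hmem.2
      omega
    obtain ⟨hj, h3⟩ := key' j hb
    have h4 : |H i (n + 1)| ≤ N + 1 := by
      have := hH.step_one i n
      rw [_root_.abs_le] at *
      omega
    refine (h'.letter _ _ _).2 ⟨i, j, h1, ⟨?_, ?_⟩, by rw [ha', hxx j i hj hi]⟩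
    · rw [← h1, ← h3 _ (by omega)]
      exact hc.1
    · rw [← h2, ← h3 _ h4]
      exact hc.2

/-- If two weaves agree on a large box of labels, then they agree on a box around the origin. -/
theorem IsWeave.eq_of_agree (hH : IsRibbonFamily H) (hV : IsRibbonFamily V)
    (hH' : IsRibbonFamily H') (hV' : IsRibbonFamily V')
    (h : IsWeave H V x y) (h' : IsWeave H' V' x' y') {N I : ℤ}
    (hI : 2 * N + |H 0 0| + |V 0 0| + 4 ≤ I)
    (hHH : ∀ i n, |i| ≤ I → |n| ≤ I → H i n = H' i n)
    (hVV : ∀ j m, |j| ≤ I → |m| ≤ I → V j m = V' j m)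
    (hxx : ∀ j i, |j| ≤ I → |i| ≤ I → x (j, i) = x' (j, i)) {n m : ℤ} (hn : |n| ≤ N)
    (hm : |m| ≤ N) : y (n, m) = y' (n, m) := by
  have hI0 : |(0 : ℤ)| ≤ I := by
    have := abs_nonneg (H 0 0)
    have := abs_nonneg (V 0 0)
    have := abs_nonneg n
    rw [abs_zero]
    omega
  obtain ⟨h1, h2, h3⟩ := h.eq_some_of_agree hH hV h' hI hHH hVV hxx hn hm
  obtain ⟨h1', h2', h3'⟩ := h'.eq_some_of_agree hH' hV' h (N := N) (I := I)
    (by rwa [← hHH 0 0 hI0 hI0, ← hVV 0 0 hI0 hI0])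
    (fun i n hi hn => (hHH i n hi hn).symm) (fun i n hi hn => (hVV i n hi hn).symm)
    (fun i n hi hn => (hxx i n hi hn).symm) hn hm
  exact Prod.ext (Option.ext fun d => ⟨h1 d, h1' d⟩)
    (Prod.ext (Option.ext fun d => ⟨h2 d, h2' d⟩) (Option.ext fun d => ⟨h3 d, h3' d⟩))

end Weaves

/-! ### Shifts and the fabric map -/

section Shifts

variable {A : Type u} {x x' : Config A} {y : Config (Symbol A)}

theorem shift_eq (g : ℤ × ℤ) (x : Config A) : shift g x = fun h => x (h - g) := rfl

theorem shift_zero (x : Config A) : shift 0 x = x := by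
  funext h
  simp [shift]

theorem continuous_shift [TopologicalSpace A] (g : ℤ × ℤ) : Continuous (shift (A := A) g) :=
  continuous_pi fun _ => continuous_apply _

theorem shift_mem_fabric (g : ℤ × ℤ) (hy : y ∈ fabric x) : shift g y ∈ fabric x := by
  obtain ⟨H, V, hH, hV, h⟩ := hy
  refine ⟨_, _, hH.translate 0 (-g.1) (-g.2), hV.translate 0 (-g.2) (-g.1), ?_⟩
  simpa [shift_eq, sub_eq_add_neg] using h.translate (-g) 0

theorem exists_eq_shift_of_mem_fabric (hy : y ∈ fabric x) (hy' : y ∈ fabric x') :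
    ∃ k, x' = shift k x := by
  obtain ⟨H, V, hH, hV, h⟩ := hy
  obtain ⟨H', V', hH', hV', h'⟩ := hy'
  obtain ⟨k, hk⟩ := h.exists_translate_eq hH hV hH' hV' h'
  exact ⟨-k, funext fun p => by simpa [shift] using hk p⟩

theorem mem_fabricSet {W : Set (Config A)} : y ∈ fabricSet W ↔ ∃ x ∈ W, y ∈ fabric x := by
  simp [fabricSet]

theorem mem_fabricRel {R : Set (Config A × Config A)}
    {p : Config (Symbol A) × Config (Symbol A)} :
    p ∈ fabricRel R ↔ ∃ q ∈ R, p.1 ∈ fabric q.1 ∧ p.2 ∈ fabric q.2 := by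
  simp only [fabricRel, mem_iUnion, mem_prod, exists_prop]

theorem fabricRel_mono {R S : Set (Config A × Config A)} (h : R ⊆ S) :
    fabricRel R ⊆ fabricRel S :=
  biUnion_subset_biUnion_left h

theorem fabricRel_prod (W : Set (Config A)) :
    fabricRel (W ×ˢ W) = fabricSet W ×ˢ fabricSet W := by
  ext p
  simp only [mem_fabricRel, mem_prod, mem_fabricSet, Prod.exists]
  constructor
  · rintro ⟨a, b, ⟨ha, hb⟩, h1, h2⟩
    exact ⟨⟨a, ha, h1⟩, b, hb, h2⟩
  · rintro ⟨⟨a, ha, h1⟩, b, hb, h2⟩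
    exact ⟨a, b, ⟨ha, hb⟩, h1, h2⟩

end Shifts

/-! ### Compactness of the space of weaves -/

section Compactness

variable {A : Type u}

theorem eventually_eq_of_continuousAt {X D : Type*} [TopologicalSpace X] [TopologicalSpace D]
    [DiscreteTopology D] {f : X → D} {q : X} (hf : ContinuousAt f q) :
    ∀ᶠ p in 𝓝 q, f p = f q :=
  hf.eventually (p := fun d => d = f q) (by
    rw [nhds_discrete]
    exact eventually_pure.2 (Eq.refl (f q)))

theorem eventually_forall_abs_le {X D : Type*} [TopologicalSpace X] [TopologicalSpace D]
    [DiscreteTopology D] {f : X → ℤ → ℤ → D} (hf : ∀ i n, Continuous fun p => f p i n) (q : X)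
    (I : ℤ) : ∀ᶠ p in 𝓝 q, ∀ i n, |i| ≤ I → |n| ≤ I → f p i n = f q i n := by
  have : ∀ᶠ p in 𝓝 q, ∀ i ∈ Icc (-I) I, ∀ n ∈ Icc (-I) I, f p i n = f q i n := by
    rw [eventually_all_finite (finite_Icc _ _)]
    intro i _
    rw [eventually_all_finite (finite_Icc _ _)]
    exact fun n _ => eventually_eq_of_continuousAt (hf i n).continuousAt
  exact this.mono fun p hp i n hi hn => hp i (abs_le.1 hi) n (abs_le.1 hn)

theorem isClosed_setOf_isRibbonFamily : IsClosed {R : ℤ → ℤ → ℤ | IsRibbonFamily R} := by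
  have hc : ∀ i n, Continuous fun R : ℤ → ℤ → ℤ => R i n := fun i n => by fun_prop
  have : {R : ℤ → ℤ → ℤ | IsRibbonFamily R} =
      {R | ∀ i n, |R i (n + 1) - R i n| ≤ 1 ∧ |R i (n + 2) - R i n| ≤ 1 ∧
        2 ≤ R (i + 1) n - R i n ∧ R (i + 1) n - R i n ≤ 4} := by
    ext R
    exact ⟨fun h i n => ⟨h.1 i n, h.2 i n, h.3 i n, h.4 i n⟩,
      fun h => ⟨fun i n => (h i n).1, fun i n => (h i n).2.1, fun i n => (h i n).2.2.1,
        fun i n => (h i n).2.2.2⟩⟩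
  rw [this]
  simp only [ofPred_forall, ofPred_and]
  refine isClosed_iInter fun i => isClosed_iInter fun n => ?_
  exact (isClosed_le (by fun_prop) continuous_const).inter
    ((isClosed_le (by fun_prop) continuous_const).inter
    ((isClosed_le continuous_const (by fun_prop)).inter
    (isClosed_le (by fun_prop) continuous_const)))

/-- Ribbon families whose ribbon number `0` passes close to the origin. -/
def normalizedRibbons : Set (ℤ → ℤ → ℤ) := {R | IsRibbonFamily R ∧ R 0 0 ∈ Icc (-4 : ℤ) 0}

/-- Normalization confines each value `R i n` to a finite interval, so Tychonoff's theorem applies.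
-/
theorem isCompact_normalizedRibbons : IsCompact normalizedRibbons := by
  have hK : IsCompact (univ.pi fun i : ℤ => univ.pi fun n : ℤ =>
      Icc (-(4 * |i| + |n| + 4)) (4 * |i| + |n| + 4)) :=
    isCompact_univ_pi fun i => isCompact_univ_pi fun n => (finite_Icc _ _).isCompact
  refine hK.of_isClosed_subset ?_ ?_
  · refine isClosed_setOf_isRibbonFamily.inter ?_
    exact (isClosed_discrete (Icc (-4 : ℤ) 0)).preimage
      (show Continuous fun R : ℤ → ℤ → ℤ => R 0 0 by fun_prop)
  · rintro R ⟨hR, h0⟩ i - n -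
    refine abs_le.1 ?_
    have := hR.abs_le i n
    have : |R 0 0| ≤ 4 := abs_le.2 ⟨h0.1, h0.2.trans (by norm_num)⟩
    omega

/-- All ways to print configurations on normalized fabrics. -/
def weaves (A : Type u) :
    Set ((ℤ → ℤ → ℤ) × (ℤ → ℤ → ℤ) × Config A × Config (Symbol A)) :=
  {q | q.1 ∈ normalizedRibbons ∧ q.2.1 ∈ normalizedRibbons ∧ IsWeave q.1 q.2.1 q.2.2.1 q.2.2.2}

theorem IsWeave.unique {H V : ℤ → ℤ → ℤ} {x : Config A} {y y' : Config (Symbol A)}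
    (hH : IsRibbonFamily H) (hV : IsRibbonFamily V)
    (h : IsWeave H V x y) (h' : IsWeave H V x y') : y = y' :=
  funext fun p => h.eq_of_agree hH hV hH hV h' (N := max |p.1| |p.2|) le_rfl
    (fun _ _ _ _ => rfl) (fun _ _ _ _ => rfl) (fun _ _ _ _ => rfl) (le_max_left _ _)
    (le_max_right _ _)

/-- Every fabric with a print on it has normalized ribbons, after a shift of the printed
configuration. -/
theorem exists_mem_weaves {x : Config A} {y : Config (Symbol A)} (hy : y ∈ fabric x) :
    ∃ k H V, (H, V, shift k x, y) ∈ weaves A := by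
  obtain ⟨H, V, hH, hV, h⟩ := hy
  obtain ⟨a, ha⟩ := hH.exists_index
  obtain ⟨b, hb⟩ := hV.exists_index
  refine ⟨(-b, -a), _, _, ⟨hH.translate a 0 0, by simpa using ha⟩,
    ⟨hV.translate b 0 0, by simpa using hb⟩, ?_⟩
  have := h.translate 0 (b, a)
  simpa [shift_eq, sub_eq_add_neg] using this

variable [TopologicalSpace A] [DiscreteTopology A]

theorem isClosed_weaves : IsClosed (weaves A) := by
  refine isClosed_of_closure_subset fun q hq => ?_
  have hN := isCompact_normalizedRibbons.isClosed
  have h1 : q.1 ∈ normalizedRibbons :=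
    closure_minimal (fun p hp => hp.1) (hN.preimage continuous_fst) hq
  have h2 : q.2.1 ∈ normalizedRibbons :=
    closure_minimal (fun p hp => hp.2.1) (hN.preimage (continuous_fst.comp continuous_snd)) hq
  refine ⟨h1, h2, ?_⟩
  -- The limit ribbons carry a genuine weave `y` of the limit configuration. At each site, a weave
  -- close to `q` agrees both with `y`, by local determinacy, and with the last component of `q`.
  obtain ⟨y, hy⟩ := exists_isWeave h1.1 h2.1 q.2.2.1
  suffices h : q.2.2.2 = y by rwa [h]
  funext p
  set I := 2 * max |p.1| |p.2| + |q.1 0 0| + |q.2.1 0 0| + 4 with hI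
  have e1 := eventually_forall_abs_le
    (f := fun q : (ℤ → ℤ → ℤ) × (ℤ → ℤ → ℤ) × Config A × Config (Symbol A) => q.1)
    (fun i n => by fun_prop) q I
  have e2 := eventually_forall_abs_le
    (f := fun q : (ℤ → ℤ → ℤ) × (ℤ → ℤ → ℤ) × Config A × Config (Symbol A) => q.2.1)
    (fun i n => by fun_prop) q I
  have e3 := eventually_forall_abs_le
    (f := fun (q : (ℤ → ℤ → ℤ) × (ℤ → ℤ → ℤ) × Config A × Config (Symbol A)) j i => q.2.2.1 (j, i))
    (fun i n => by fun_prop) q I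
  have e4 := eventually_eq_of_continuousAt (q := q)
    (f := fun q : (ℤ → ℤ → ℤ) × (ℤ → ℤ → ℤ) × Config A × Config (Symbol A) => q.2.2.2 p)
    (by fun_prop)
  obtain ⟨r, hr, h3, h4, h5, h6⟩ :=
    ((mem_closure_iff_frequently.1 hq).and_eventually (e1.and (e2.and (e3.and e4)))).exists
  rw [← h6]
  exact (hy.eq_of_agree h1.1 h2.1 hr.1.1 hr.2.1.1 hr.2.2 (N := max |p.1| |p.2|) hI.ge
    (fun i n hi hn => (h3 i n hi hn).symm) (fun i n hi hn => (h4 i n hi hn).symm)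
    (fun i n hi hn => (h5 i n hi hn).symm) (le_max_left _ _) (le_max_right _ _)).symm

theorem isCompact_weaves [Finite A] : IsCompact (weaves A) :=
  (isCompact_normalizedRibbons.prod
    (isCompact_normalizedRibbons.prod isCompact_univ)).of_isClosed_subset isClosed_weaves
    fun _ hq => ⟨hq.1, hq.2.1, mem_univ _⟩

/-- The set is a projection of a compact set of weaves. Normalizing the ribbons shifts the printed
configuration, which is why shift invariance is needed. -/
theorem isClosed_fabricSet [Finite A] {W : Set (Config A)} (hW : IsClosed W)
    (hinv : ∀ g, ∀ x ∈ W, shift g x ∈ W) : IsClosed (fabricSet W) := by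
  have h : fabricSet W = (fun q => q.2.2.2) '' (weaves A ∩ (fun q => q.2.2.1) ⁻¹' W) := by
    ext y
    rw [mem_fabricSet]
    constructor
    · rintro ⟨x, hx, hy⟩
      obtain ⟨k, H, V, h⟩ := exists_mem_weaves hy
      exact ⟨_, ⟨h, hinv k x hx⟩, rfl⟩
    · rintro ⟨⟨H, V, x, y⟩, ⟨h, hx⟩, rfl⟩
      exact ⟨x, hx, H, V, h.1.1, h.2.1.1, h.2.2⟩
  rw [h]
  exact ((isCompact_weaves.inter_right (hW.preimage (by fun_prop))).image (by fun_prop)).isClosed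

theorem isSubshift_fabricSet [Finite A] {W : Set (Config A)} (hW : IsSubshift W) :
    IsSubshift (fabricSet W) where
  isClosed := isClosed_fabricSet hW.isClosed hW.shift_mem
  shift_mem g y hy := by
    obtain ⟨x, hx, hy⟩ := mem_fabricSet.1 hy
    exact mem_fabricSet.2 ⟨x, hx, shift_mem_fabric g hy⟩

theorem isClosed_fabricRel [Finite A] {R : Set (Config A × Config A)} (hR : IsClosed R)
    (hinv : ∀ g h, ∀ p ∈ R, (shift g p.1, shift h p.2) ∈ R) : IsClosed (fabricRel R) := by
  have h : fabricRel R = (fun q => (q.1.2.2.2, q.2.2.2.2)) ''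
      ((weaves A ×ˢ weaves A) ∩ (fun q => (q.1.2.2.1, q.2.2.2.1)) ⁻¹' R) := by
    ext ⟨y, y'⟩
    rw [mem_fabricRel]
    constructor
    · rintro ⟨⟨x, x'⟩, hx, hy, hy'⟩
      obtain ⟨k, H, V, h⟩ := exists_mem_weaves hy
      obtain ⟨k', H', V', h'⟩ := exists_mem_weaves hy'
      exact ⟨(_, _), ⟨⟨h, h'⟩, hinv k k' _ hx⟩, rfl⟩
    · rintro ⟨⟨⟨H, V, x, z⟩, ⟨H', V', x', z'⟩⟩, ⟨⟨h, h'⟩, hx⟩, he⟩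
      obtain ⟨rfl, rfl⟩ := Prod.mk.inj he
      exact ⟨_, hx, ⟨H, V, h.1.1, h.2.1.1, h.2.2⟩, ⟨H', V', h'.1.1, h'.2.1.1, h'.2.2⟩⟩
  rw [h]
  exact (((isCompact_weaves.prod isCompact_weaves).inter_right
    (hR.preimage (by fun_prop))).image (by fun_prop)).isClosed

/-- The print on a fixed fabric depends continuously on the printed configuration. -/
theorem exists_continuous_isWeave {H V : ℤ → ℤ → ℤ} (hH : IsRibbonFamily H)
    (hV : IsRibbonFamily V) :
    ∃ F : Config A → Config (Symbol A), Continuous F ∧ ∀ x, IsWeave H V x (F x) := by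
  choose F hF using fun x : Config A => exists_isWeave hH hV x
  refine ⟨F, continuous_pi fun p => continuous_iff_continuousAt.2 fun x => ?_, hF⟩
  rw [ContinuousAt, nhds_discrete (Symbol A), tendsto_pure]
  set I := 2 * max |p.1| |p.2| + |H 0 0| + |V 0 0| + 4 with hI
  have e := eventually_forall_abs_le (f := fun (x : Config A) j i => x (j, i))
    (fun i n => by fun_prop) x I
  exact e.mono fun x' hx' => (hF x').eq_of_agree hH hV hH hV (hF x) (N := max |p.1| |p.2|) hI.ge
    (fun _ _ _ _ => rfl) (fun _ _ _ _ => rfl) hx' (le_max_left _ _) (le_max_right _ _)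

/-- Keep the ribbons of both fabrics fixed and vary only the printed configurations, which enter
continuously. -/
theorem fabricRel_closure_subset (R : Set (Config A × Config A)) :
    fabricRel (closure R) ⊆ closure (fabricRel R) := by
  rintro ⟨y, y'⟩ h
  obtain ⟨⟨x, x'⟩, hx, ⟨H, V, hH, hV, hy⟩, ⟨H', V', hH', hV', hy'⟩⟩ := mem_fabricRel.1 h
  obtain ⟨F, hF, hFw⟩ := exists_continuous_isWeave (A := A) hH hV
  obtain ⟨F', hF', hFw'⟩ := exists_continuous_isWeave (A := A) hH' hV'
  obtain rfl := hy.unique hH hV (hFw x)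
  obtain rfl := hy'.unique hH' hV' (hFw' x')
  exact map_mem_closure (f := Prod.map F F') (hF.prodMap hF') hx fun p hp =>
    mem_fabricRel.2 ⟨p, hp, ⟨H, V, hH, hV, hFw p.1⟩, ⟨H', V', hH', hV', hFw' p.2⟩⟩

theorem fabricRel_closure [Finite A] {R : Set (Config A × Config A)}
    (hinv : ∀ g h, ∀ p ∈ R, (shift g p.1, shift h p.2) ∈ R) :
    fabricRel (closure R) = closure (fabricRel R) := by
  refine (fabricRel_closure_subset R).antisymm (closure_minimal (fabricRel_mono subset_closure)
    (isClosed_fabricRel isClosed_closure fun g h p hp => ?_))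
  exact map_mem_closure (f := Prod.map (shift g) (shift h))
    ((continuous_shift g).prodMap (continuous_shift h)) hp (hinv g h)

end Compactness

/-! ### Transfinite iteration -/

section Levels

variable {P : Type u} {base : Set P} {step : Set P → Set P}

theorem levels_zero : levels base step 0 = base := by
  simp [levels]

theorem levels_one : levels base step 1 = base := by
  have h : levels base step (0 + 1) = base := by
    unfold levels
    rw [Ordinal.limitRecOn_add_one, if_pos rfl]
  rwa [zero_add] at h

theorem levels_add_one {α : Ordinal.{0}} (hα : α ≠ 0) :
    levels base step (α + 1) = step (levels base step α) := by
  unfold levels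
  rw [Ordinal.limitRecOn_add_one, if_neg hα]

/-- The union includes level `0`; this is harmless, since level `0` equals level `1`. -/
theorem levels_limit {α : Ordinal.{0}} (hα : Order.IsSuccLimit α) :
    levels base step α = ⋃ β : Iio α, levels base step β := by
  rw [levels, Ordinal.limitRecOn_limit _ _ _ _ hα, iUnion_subtype]
  rfl

/-- A property of the levels of the iteration that holds for the base and is preserved under steps
and unions holds for all levels. -/
theorem levels_induction {Q : Ordinal.{0} → Prop} (h0 : Q 0) (h1 : Q 1)
    (hstep : ∀ α, α ≠ 0 → Q α → Q (α + 1))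
    (hlim : ∀ α, Order.IsSuccLimit α → (∀ β < α, Q β) → Q α) (α : Ordinal.{0}) : Q α := by
  induction α using Ordinal.limitRecOn with
  | zero => exact h0
  | add_one β ih =>
    rcases eq_or_ne β 0 with rfl | hβ
    · simpa using h1
    · simpa using hstep β hβ ih
  | limit β hβ ih => exact hlim β hβ ih

theorem levels_mono (hstep : ∀ S, S ⊆ step S) : Monotone (levels base step) := by
  have key : ∀ β α, α ≤ β → levels base step α ⊆ levels base step β := by
    intro β
    refine levels_induction (Q := fun β => ∀ α, α ≤ β → levels base step α ⊆ levels base step β)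
      ?_ ?_ ?_ ?_ β
    · intro α hα
      rw [nonpos_iff_eq_zero.1 hα]
    · intro α hα
      rcases hα.lt_or_eq with h | rfl
      · rw [Order.lt_one_iff.1 h, levels_zero, levels_one]
      · exact subset_rfl
    · intro β hβ ih α hα
      rcases hα.lt_or_eq with h | rfl
      · rw [levels_add_one hβ]
        exact (ih α (Order.lt_add_one_iff.1 h)).trans (hstep _)
      · exact subset_rfl
    · intro β hβ _ α hα
      rcases hα.lt_or_eq with h | rfl
      · rw [levels_limit hβ]
        exact subset_iUnion (fun γ : Iio β => levels base step γ) ⟨α, h⟩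
      · exact subset_rfl
  exact fun α β h => key β α h

/-- In a second countable space, the closures of an increasing `ω₁`-sequence of sets
stabilize. -/
theorem exists_closure_eq_of_monotone {X : Type*} [TopologicalSpace X] [SecondCountableTopology X]
    {S : Ordinal.{0} → Set X} (hS : Monotone S) :
    ∃ α, 1 ≤ α ∧ α < Ordinal.omega 1 ∧
      ∀ β, α ≤ β → β < Ordinal.omega 1 → closure (S β) = closure (S α) := by
  classical
  -- Each basic open set has a first level that meets it, if any does before `ω₁` (otherwise the
  -- infimum defaults to `0`). The supremum of these countably many levels stays below `ω₁`.
  let D : TopologicalSpace.countableBasis X → Set Ordinal.{0} := fun U =>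
    {α | α < Ordinal.omega 1 ∧ (U.1 ∩ S α).Nonempty}
  have h1 : (1 : Ordinal.{0}) < Ordinal.omega 1 :=
    Ordinal.one_lt_omega0.trans Ordinal.omega0_lt_omega_one
  have hlt : ∀ U, sInf (D U) < Ordinal.omega 1 := fun U => by
    rcases (D U).eq_empty_or_nonempty with h | h
    · rw [h, Ordinal.sInf_empty]
      exact zero_lt_one.trans h1
    · exact (csInf_mem h).1
  have hsup := Ordinal.iSup_lt_omega_one hlt
  refine ⟨max 1 (⨆ U, sInf (D U)), le_max_left _ _, max_lt h1 hsup, fun β hβ hβ' => ?_⟩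
  refine Subset.antisymm (fun x hx => ?_) (closure_mono (hS hβ))
  rw [(TopologicalSpace.isBasis_countableBasis X).mem_closure_iff] at hx ⊢
  intro U hU hxU
  have hne : (D ⟨U, hU⟩).Nonempty := ⟨β, hβ', hx U hU hxU⟩
  refine (csInf_mem hne).2.mono (inter_subset_inter_right _ (hS ?_))
  exact (Ordinal.le_iSup (fun U => sInf (D U)) ⟨U, hU⟩).trans (le_max_right _ _)

end Levels

/-! ### Relations invariant under independent shifts -/

section Relations

variable {A : Type u}

/-- A reflexive, symmetric relation on `W` that is invariant under independent shifts of both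
points. -/
structure IsShiftTolerance (W : Set (Config A)) (R : Set (Config A × Config A)) : Prop where
  subset : R ⊆ W ×ˢ W
  refl : ∀ x ∈ W, (x, x) ∈ R
  symm : ∀ p ∈ R, p.swap ∈ R
  shift_mem : ∀ g h, ∀ p ∈ R, (shift g p.1, shift h p.2) ∈ R

theorem Pattern.AppearsIn.of_shift {w : Pattern A} {x : Config A} {g : ℤ × ℤ}
    (h : w.AppearsIn (shift g x)) : w.AppearsIn x := by
  obtain ⟨k, hk⟩ := h
  exact ⟨k - g, fun s => by rw [← hk s, shift, add_sub_assoc]⟩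

variable {W : Set (Config A)} {R S : Set (Config A × Config A)}

theorem IsSubshift.transitivityPairs [TopologicalSpace A] (hW : IsSubshift W) :
    IsShiftTolerance W (transitivityPairs W) where
  subset _ hp := ⟨hp.1, hp.2.1⟩
  refl x hx := ⟨hx, hx, fun _ _ hv hv' => ⟨x, hx, hv, hv'⟩⟩
  symm p hp := ⟨hp.2.1, hp.1, fun v v' hv hv' => by
    obtain ⟨z, hz, h, h'⟩ := hp.2.2 v' v hv' hv
    exact ⟨z, hz, h', h⟩⟩
  shift_mem g h p hp := ⟨hW.shift_mem g _ hp.1, hW.shift_mem h _ hp.2.1,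
    fun v v' hv hv' => hp.2.2 v v' hv.of_shift hv'.of_shift⟩

theorem IsShiftTolerance.closure [TopologicalSpace A] (hW : IsSubshift W)
    (hR : IsShiftTolerance W R) :
    IsShiftTolerance W (closure R) where
  subset := closure_minimal hR.subset (hW.isClosed.prod hW.isClosed)
  refl x hx := subset_closure (hR.refl x hx)
  symm _ hp := map_mem_closure continuous_swap hp hR.symm
  shift_mem g h _ hp := map_mem_closure (f := Prod.map (shift g) (shift h))
    ((continuous_shift g).prodMap (continuous_shift h)) hp (hR.shift_mem g h)

theorem subset_transClosure {Z : Type*} (R : Set (Z × Z)) : R ⊆ transClosure R :=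
  fun _ hp => Relation.TransGen.single hp

/-- The first and last links of a chain absorb the shifts of its endpoints; the intermediate points
stay put. -/
theorem transClosure_shift_mem (hR : ∀ g h, ∀ p ∈ R, (shift g p.1, shift h p.2) ∈ R)
    (g h : ℤ × ℤ) {x x' : Config A} (hp : (x, x') ∈ transClosure R) :
    (shift g x, shift h x') ∈ transClosure R := by
  have hr : ∀ {a b : Config A} (h : ℤ × ℤ), Relation.TransGen (fun a b => (a, b) ∈ R) a b →
      Relation.TransGen (fun a b => (a, b) ∈ R) a (shift h b) := by
    intro a b h hab
    cases hab with
    | single hab => exact .single (by simpa [shift_zero] using hR 0 h _ hab)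
    | tail hac hcb => exact hac.tail (by simpa [shift_zero] using hR 0 h _ hcb)
  have hl : ∀ {a b : Config A} (g : ℤ × ℤ), Relation.TransGen (fun a b => (a, b) ∈ R) a b →
      Relation.TransGen (fun a b => (a, b) ∈ R) (shift g a) b := by
    intro a b g hab
    rcases Relation.TransGen.head'_iff.1 hab with ⟨c, hac, hcb⟩
    exact Relation.TransGen.head' (by simpa [shift_zero] using hR g 0 _ hac) hcb
  exact hl g (hr h hp)

theorem IsShiftTolerance.transClosure (hR : IsShiftTolerance W R) :
    IsShiftTolerance W (transClosure R) where
  subset := by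
    rintro ⟨x, x'⟩ hp
    obtain ⟨c, hc, -⟩ := Relation.TransGen.head'_iff.1 hp
    obtain ⟨d, -, hd⟩ := Relation.TransGen.tail'_iff.1 hp
    exact ⟨(hR.subset hc).1, (hR.subset hd).2⟩
  refl x hx := subset_transClosure R (hR.refl x hx)
  symm := by
    rintro ⟨x, x'⟩ hp
    have : Std.Symm (fun a b => (a, b) ∈ R) := ⟨fun a b hab => hR.symm _ hab⟩
    exact Relation.TransGen.stdSymm.symm _ _ hp
  shift_mem g h p hp := transClosure_shift_mem hR.shift_mem g h hp

theorem IsShiftTolerance.iUnion {ι : Type*} [Nonempty ι] {R : ι → Set (Config A × Config A)}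
    (hR : ∀ i, IsShiftTolerance W (R i)) : IsShiftTolerance W (⋃ i, R i) where
  subset := iUnion_subset fun i => (hR i).subset
  refl x hx := mem_iUnion.2 ⟨Classical.arbitrary ι, (hR _).refl x hx⟩
  symm p hp := by
    obtain ⟨i, hi⟩ := mem_iUnion.1 hp
    exact mem_iUnion.2 ⟨i, (hR i).symm p hi⟩
  shift_mem g h p hp := by
    obtain ⟨i, hi⟩ := mem_iUnion.1 hp
    exact mem_iUnion.2 ⟨i, (hR i).shift_mem g h p hi⟩

theorem mem_of_mem_fabricRel (hS : IsShiftTolerance W S) {x x' : Config A}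
    {y y' : Config (Symbol A)} (hy : y ∈ fabric x) (hy' : y' ∈ fabric x')
    (h : (y, y') ∈ fabricRel S) : (x, x') ∈ S := by
  obtain ⟨⟨a, b⟩, hab, ha, hb⟩ := mem_fabricRel.1 h
  obtain ⟨k, rfl⟩ := exists_eq_shift_of_mem_fabric ha hy
  obtain ⟨l, rfl⟩ := exists_eq_shift_of_mem_fabric hb hy'
  exact hS.shift_mem k l _ hab

theorem fabricRel_subset_iff (hS : IsShiftTolerance W S) :
    fabricRel R ⊆ fabricRel S ↔ R ⊆ S := by
  refine ⟨fun h => ?_, fabricRel_mono⟩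
  rintro ⟨x, x'⟩ hx
  obtain ⟨y, hy⟩ := fabric_nonempty x
  obtain ⟨y', hy'⟩ := fabric_nonempty x'
  exact mem_of_mem_fabricRel hS hy hy' (h (mem_fabricRel.2 ⟨_, hx, hy, hy'⟩))

theorem fabricRel_inj (hR : IsShiftTolerance W R) (hS : IsShiftTolerance W S) :
    fabricRel R = fabricRel S ↔ R = S := by
  simp only [subset_antisymm_iff, fabricRel_subset_iff hS, fabricRel_subset_iff hR]

theorem isClosed_fabricRel_iff [TopologicalSpace A] [Finite A] [DiscreteTopology A]
    (hW : IsSubshift W) (hR : IsShiftTolerance W R) : IsClosed (fabricRel R) ↔ IsClosed R := by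
  refine ⟨fun h => ?_, fun h => isClosed_fabricRel h hR.shift_mem⟩
  rw [← closure_eq_iff_isClosed, ← fabricRel_closure hR.shift_mem,
    fabricRel_inj (hR.closure hW) hR] at h
  exact closure_eq_iff_isClosed.1 h

/-- A chain of configurations lifts by choosing any print of each intermediate point. In a chain of
fabrics, two links meeting in a fabric may read it as different configurations, but these differ by
a shift, which the relation absorbs. -/
theorem fabricRel_transClosure (hR : IsShiftTolerance W R) :
    fabricRel (transClosure R) = transSymmClosure (fabricRel R) := by
  apply Subset.antisymm
  · rintro ⟨y, y'⟩ h
    obtain ⟨⟨x, x'⟩, hx, hy, hy'⟩ := mem_fabricRel.1 h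
    simp only at hy hy'
    replace hx : Relation.TransGen (fun a b => (a, b) ∈ R) x x' := hx
    clear h
    induction hx generalizing y' with
    | single hab =>
      exact Relation.TransGen.single (Or.inl (mem_fabricRel.2 ⟨_, hab, hy, hy'⟩))
    | @tail b c hab hbc ih =>
      obtain ⟨z, hz⟩ := fabric_nonempty b
      exact (ih z hz).tail (Or.inl (mem_fabricRel.2 ⟨_, hbc, hz, hy'⟩))
  · rintro ⟨y, y'⟩ h
    replace h : Relation.TransGen (Relation.SymmGen fun a b => (a, b) ∈ fabricRel R) y y' := h
    have hsymm : ∀ a b, Relation.SymmGen (fun a b => (a, b) ∈ fabricRel R) a b →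
        (a, b) ∈ fabricRel R := by
      rintro a b (hab | hab)
      · exact hab
      · obtain ⟨q, hq, h1, h2⟩ := mem_fabricRel.1 hab
        exact mem_fabricRel.2 ⟨q.swap, hR.symm q hq, h2, h1⟩
    induction h with
    | single hab => exact fabricRel_mono (subset_transClosure R) (hsymm _ _ hab)
    | tail _ hbc ih =>
      obtain ⟨⟨a, b⟩, hab, ha, hb⟩ := mem_fabricRel.1 ih
      obtain ⟨⟨b', c⟩, hbc', hb', hc⟩ := mem_fabricRel.1 (hsymm _ _ hbc)
      obtain ⟨k, rfl⟩ := exists_eq_shift_of_mem_fabric hb hb'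
      refine mem_fabricRel.2 ⟨(a, c), ?_, ha, hc⟩
      have := transClosure_shift_mem hR.shift_mem 0 k hab
      rw [shift_zero] at this
      exact Relation.TransGen.tail this hbc'

theorem transClosure_eq_of_isEquivOn (hR : IsShiftTolerance W R)
    (h : IsEquivOn (fabricSet W) (fabricRel R)) : transClosure R = R := by
  refine Subset.antisymm ?_ (subset_transClosure R)
  rintro ⟨x, x'⟩ hx
  replace hx : Relation.TransGen (fun a b => (a, b) ∈ R) x x' := hx
  induction hx with
  | single hab => exact hab
  | @tail b c _ hbc ih =>
    obtain ⟨y, hy⟩ := fabric_nonempty x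
    obtain ⟨z, hz⟩ := fabric_nonempty b
    obtain ⟨y', hy'⟩ := fabric_nonempty c
    exact mem_of_mem_fabricRel hR hy hy' (h.2.2 y z y' (mem_fabricRel.2 ⟨_, ih, hy, hz⟩)
      (mem_fabricRel.2 ⟨_, hbc, hz, hy'⟩))

theorem isEquivOn_fabricRel (hR : IsShiftTolerance W R) (h : transClosure R = R) :
    IsEquivOn (fabricSet W) (fabricRel R) := by
  refine ⟨fun y hy => ?_, fun y y' hy => ?_, fun x y z hxy hyz => ?_⟩
  · obtain ⟨x, hx, hy⟩ := mem_fabricSet.1 hy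
    exact mem_fabricRel.2 ⟨_, hR.refl x hx, hy, hy⟩
  · obtain ⟨q, hq, h1, h2⟩ := mem_fabricRel.1 hy
    exact mem_fabricRel.2 ⟨q.swap, hR.symm q hq, h2, h1⟩
  · rw [← h, fabricRel_transClosure hR]
    exact Relation.TransGen.tail (b := y) (.single (Or.inl hxy)) (Or.inl hyz)

theorem IsShiftTolerance.transitivityStep [TopologicalSpace A] (hW : IsSubshift W)
    (hR : IsShiftTolerance W R) : IsShiftTolerance W (transitivityStep R) := by
  unfold Fabric.transitivityStep
  split_ifs
  exacts [hR.transClosure, hR.closure hW]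

theorem subset_transitivityStep [TopologicalSpace A] (R : Set (Config A × Config A)) :
    R ⊆ transitivityStep R := by
  unfold transitivityStep
  split_ifs
  exacts [subset_transClosure R, subset_closure]

/-- The definitions differ when the relation is closed: `entropyStep` first tests for an equivalence
relation. If the test succeeds, the transitive closure taken by `transitivityStep` changes nothing.
-/
theorem fabricRel_transitivityStep [TopologicalSpace A] [Finite A] [DiscreteTopology A]
    (hW : IsSubshift W) (hR : IsShiftTolerance W R) :
    fabricRel (transitivityStep R) = entropyStep (fabricSet W) (fabricRel R) := by
  unfold transitivityStep entropyStep
  rw [isClosed_fabricRel_iff hW hR]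
  by_cases hc : IsClosed R
  · rw [if_pos hc, if_neg (not_not.2 hc)]
    by_cases he : IsEquivOn (fabricSet W) (fabricRel R)
    · rw [if_neg (not_not.2 he), transClosure_eq_of_isEquivOn hR he]
    · rw [if_pos he, fabricRel_transClosure hR]
  · rw [if_neg hc, if_pos hc, fabricRel_closure hR.shift_mem]

theorem fabricRel_iUnion {ι : Sort*} (R : ι → Set (Config A × Config A)) :
    fabricRel (⋃ i, R i) = ⋃ i, fabricRel (R i) :=
  biUnion_iUnion _ _

theorem IsSubshift.isShiftTolerance_T [TopologicalSpace A] (hW : IsSubshift W) (α : Ordinal.{0}) :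
    IsShiftTolerance W (T W α) := by
  have h0 := hW.transitivityPairs
  refine levels_induction (Q := fun α => IsShiftTolerance W (T W α)) ?_ ?_ ?_ ?_ α
  · rwa [T, levels_zero]
  · rwa [T, levels_one]
  · intro α hα ih
    rw [T, levels_add_one hα]
    exact ih.transitivityStep hW
  · intro α hα ih
    rw [T, levels_limit hα]
    have : Nonempty (Iio α) := ⟨⟨0, hα.bot_lt⟩⟩
    exact .iUnion fun β => ih β.1 β.2

/-- If the fabric map sends transitivity pairs to entropy-or-equal pairs, then it matches the two
hierarchies level by level. -/
theorem fabricRel_T [TopologicalSpace A] [Finite A] [DiscreteTopology A] (hW : IsSubshift W)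
    (h : fabricRel (transitivityPairs W) = entropyOrEqual (fabricSet W)) (α : Ordinal.{0}) :
    fabricRel (T W α) = E (fabricSet W) α := by
  refine levels_induction (Q := fun α => fabricRel (T W α) = E (fabricSet W) α) ?_ ?_ ?_ ?_ α
  · rw [T, E, levels_zero, levels_zero, h]
  · rw [T, E, levels_one, levels_one, h]
  · intro α hα ih
    rw [T, E, levels_add_one hα, levels_add_one hα, ← T, ← E, ← ih,
      fabricRel_transitivityStep hW (hW.isShiftTolerance_T α)]
  · intro α hα ih
    rw [T, E, levels_limit hα, levels_limit hα, fabricRel_iUnion]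
    exact iUnion_congr fun β => ih β.1 β.2

/-- The hierarchy `T` reaches a closed transitive relation before `ω₁`. -/
theorem exists_isClosed_transClosure_eq [TopologicalSpace A] [Finite A] (W : Set (Config A)) :
    ∃ α, 1 ≤ α ∧ α < Ordinal.omega 1 ∧ IsClosed (T W α) ∧ transClosure (T W α) = T W α := by
  have hmono : Monotone (T W) := levels_mono subset_transitivityStep
  have hlim := Cardinal.isSuccLimit_omega 1
  have hstep : ∀ α, 1 ≤ α → T W (α + 1) = transitivityStep (T W α) := fun α hα =>
    levels_add_one (zero_lt_one.trans_le hα).ne'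
  obtain ⟨α, h1, hα, hcl⟩ := exists_closure_eq_of_monotone hmono
  obtain ⟨β, hαβ, hβ, hclosed⟩ : ∃ β, α ≤ β ∧ β < Ordinal.omega 1 ∧ IsClosed (T W β) := by
    by_cases h : IsClosed (T W α)
    · exact ⟨α, le_rfl, hα, h⟩
    · refine ⟨α + 1, le_self_add, hlim.add_one_lt hα, ?_⟩
      rw [hstep α h1, transitivityStep, if_neg h]
      exact isClosed_closure
  refine ⟨β, h1.trans hαβ, hβ, hclosed, Subset.antisymm ?_ (subset_transClosure _)⟩
  have h2 : T W (β + 1) = transClosure (T W β) := by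
    rw [hstep β (h1.trans hαβ), transitivityStep, if_pos hclosed]
  -- Closures are constant from `α` on, so level `β + 1` lies in the closure of level `β`, which is
  -- already closed.
  rw [← h2, ← hclosed.closure_eq, hcl β hαβ hβ,
    ← hcl (β + 1) (hαβ.trans le_self_add) (hlim.add_one_lt hβ)]
  exact subset_closure

end Relations

/-! ### Deforming ribbon families -/

section Gluing

variable {R : ℤ → ℤ → ℤ}

/-- Truncation of a value to `[-s, s]` is 1-Lipschitz jointly in the value and in the bound `s`, for
the sup norm. -/
theorem abs_clamp_sub_clamp_le {a b s t : ℤ} (h : |a - b| ≤ 1) (h' : |s - t| ≤ 1) :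
    |max (min a s) (-s) - max (min b t) (-t)| ≤ 1 := by
  rw [abs_le] at *
  omega

/-- A ribbon family can be straightened outside a large box without changing it near the origin:
the displacements `R i n - 3 * i` are the Lipschitz functions for a suitable graph metric, and these
may be truncated. -/
theorem IsRibbonFamily.exists_truncate (hR : IsRibbonFamily R) (N : ℤ) :
    ∃ M, ∃ R', IsRibbonFamily R' ∧ (∀ i n, |i| ≤ N → |n| ≤ N → R' i n = R i n) ∧
      ∀ i n, M < |i| ∨ M < |n| → R' i n = 3 * i := by
  obtain ⟨L, hL⟩ : ∃ L, L = 4 * N + |R 0 0| + 1 := ⟨_, rfl⟩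
  -- In the graph joining `(i, n)` to `(i, n + 1)`, `(i, n + 2)` and `(i + 1, n)`, the distance to
  -- the origin is `|i| + (|n| + 1) / 2`. So `g` is a 1-Lipschitz bump; `L` makes it exceed all
  -- displacements in the box of size `N`, where truncation then has no effect.
  obtain ⟨g, hg⟩ : ∃ g : ℤ → ℤ → ℤ, ∀ i n, g i n = max 0 (L - |i| - (|n| + 1) / 2) :=
    ⟨_, fun _ _ => rfl⟩
  have g1 : ∀ i n, |g i (n + 1) - g i n| ≤ 1 := fun i n => by
    rw [hg, hg, _root_.abs_le]
    rcases abs_cases n with h | h <;> rcases abs_cases (n + 1) with h' | h' <;> omega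
  have g2 : ∀ i n, |g i (n + 2) - g i n| ≤ 1 := fun i n => by
    rw [hg, hg, _root_.abs_le]
    rcases abs_cases n with h | h <;> rcases abs_cases (n + 2) with h' | h' <;> omega
  have g3 : ∀ i n, |g (i + 1) n - g i n| ≤ 1 := fun i n => by
    rw [hg, hg, _root_.abs_le]
    rcases abs_cases i with h | h <;> rcases abs_cases (i + 1) with h' | h' <;> omega
  refine ⟨2 * |L| + 2, fun i n => 3 * i + max (min (R i n - 3 * i) (g i n)) (-g i n),
    ⟨fun i n => ?_, fun i n => ?_, fun i n => ?_, fun i n => ?_⟩, fun i n hi hn => ?_,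
    fun i n h => ?_⟩
  · have := abs_clamp_sub_clamp_le (a := R i (n + 1) - 3 * i) (b := R i n - 3 * i)
      (by simpa using hR.step_one i n) (g1 i n)
    simpa using this
  · have := abs_clamp_sub_clamp_le (a := R i (n + 2) - 3 * i) (b := R i n - 3 * i)
      (by simpa using hR.step_two i n) (g2 i n)
    simpa using this
  · have h1 := hR.two_le_gap i n
    have h2 := hR.gap_le_four i n
    have := abs_clamp_sub_clamp_le (a := R (i + 1) n - 3 * (i + 1)) (b := R i n - 3 * i)
      (by rw [_root_.abs_le]; omega) (g3 i n)
    rw [_root_.abs_le] at this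
    omega
  · have h1 := hR.two_le_gap i n
    have h2 := hR.gap_le_four i n
    have := abs_clamp_sub_clamp_le (a := R (i + 1) n - 3 * (i + 1)) (b := R i n - 3 * i)
      (by rw [_root_.abs_le]; omega) (g3 i n)
    rw [_root_.abs_le] at this
    omega
  · have h1 := hR.abs_index_le n i
    have h2 := hR.abs_sub_le 0 n 0
    rw [sub_zero] at h2
    have h3 : |R i n - 3 * i| ≤ 2 * N + |R 0 0| := by
      have e : R i n - 3 * i = (R i n - R 0 n - 3 * i) + (R 0 n - R 0 0) + R 0 0 := by ring
      rw [e]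
      refine (abs_add_three _ _ _).trans ?_
      omega
    have h4 : 2 * N + |R 0 0| ≤ g i n := by
      rw [hg]
      have := abs_nonneg i
      omega
    rw [_root_.abs_le] at h3
    simp only
    omega
  · have hg0 : g i n = 0 := by
      rw [hg]
      have := le_abs_self L
      have := abs_nonneg i
      have := abs_nonneg n
      omega
    simp only [hg0]
    omega

theorem ediv_eq_of_abs_sub_le {L M a i : ℤ} (hL : 2 * M < L) (h : |i - L * a| ≤ M) :
    (i + M) / L = a := by
  rw [abs_le] at h
  have e : i + M = (i - L * a + M) + L * a := by ring
  rw [e, Int.add_mul_ediv_left _ _ (by omega), Int.ediv_eq_zero_of_lt (by omega) (by omega),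
    zero_add]

/-- Ribbon families that are straight outside a box can be placed independently in the cells of a
coarse grid. -/
theorem exists_isRibbonFamily_glue {M L : ℤ} (hM : 0 ≤ M) (hL : 2 * M + 4 < L)
    {R : ℤ → ℤ → ℤ → ℤ → ℤ} (hR : ∀ a b, IsRibbonFamily (R a b))
    (hstraight : ∀ a b i n, M < |i| ∨ M < |n| → R a b i n = 3 * i) :
    ∃ Q, IsRibbonFamily Q ∧ ∀ a b i n, |i| ≤ M → |n| ≤ M →
      Q (i + L * a) (n + 3 * L * b) = R a b i n + 3 * L * a := by
  -- Copies of the families are centred at label `L * a` and column `3 * L * b`; the added height `3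
  -- * L * a` makes every copy equal to `3 * i` away from its box.
  obtain ⟨r, hr⟩ : ∃ r : ℤ → ℤ → ℤ → ℤ → ℤ, ∀ a b i n,
      r a b i n = R a b (i - L * a) (n - 3 * L * b) + 3 * L * a := ⟨_, fun _ _ _ _ => rfl⟩
  have hrib : ∀ a b, IsRibbonFamily (r a b) := fun a b => by
    have := (hR a b).translate (-(L * a)) (-(3 * L * b)) (-(3 * L * a))
    convert this using 3 with i n
    rw [hr, sub_eq_add_neg, sub_eq_add_neg, sub_neg_eq_add]
  have hr0 : ∀ a b i n, M < |i - L * a| ∨ M < |n - 3 * L * b| → r a b i n = 3 * i :=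
    fun a b i n h => by
      rw [hr, hstraight a b _ _ h]
      ring
  obtain ⟨Q, hQ⟩ : ∃ Q : ℤ → ℤ → ℤ, ∀ i n,
      Q i n = r ((i + (M + 2)) / L) ((n + (M + 2)) / (3 * L)) i n := ⟨_, fun _ _ => rfl⟩
  have hcell : ∀ a b i n, |i - L * a| ≤ M + 2 → |n - 3 * L * b| ≤ M + 2 →
      Q i n = r a b i n := fun a b i n hi hn => by
    rw [hQ, ediv_eq_of_abs_sub_le (by omega) hi, ediv_eq_of_abs_sub_le (by omega) hn]
  -- The ribbon axioms compare positions at distance at most 2. Boxes padded by 2 are disjoint and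
  -- all copies agree outside their boxes, so both values come from a single copy.
  have key : ∀ i n i' n', |i' - i| ≤ 2 → |n' - n| ≤ 2 →
      ∃ a b, Q i n = r a b i n ∧ Q i' n' = r a b i' n' := by
    intro i n i' n' hi hn
    set a := (i + (M + 2)) / L
    set b := (n + (M + 2)) / (3 * L)
    set a' := (i' + (M + 2)) / L
    set b' := (n' + (M + 2)) / (3 * L)
    by_cases h : |i - L * a| ≤ M ∧ |n - 3 * L * b| ≤ M
    · refine ⟨a, b, hQ i n, hcell a b i' n' ?_ ?_⟩
      · have := abs_sub_le i' i (L * a)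
        omega
      · have := abs_sub_le n' n (3 * L * b)
        omega
    · refine ⟨a', b', ?_, hQ i' n'⟩
      by_cases h' : |i - L * a'| ≤ M ∧ |n - 3 * L * b'| ≤ M
      · exact hcell a' b' i n (by omega) (by omega)
      · rw [hr0 a' b' i n (by omega), hQ, hr0 a b i n (by omega)]
  refine ⟨Q, ⟨fun i n => ?_, fun i n => ?_, fun i n => ?_, fun i n => ?_⟩, fun a b i n hi hn => ?_⟩
  · obtain ⟨a, b, h1, h2⟩ := key i n i (n + 1) (by simp) (by simp)
    rw [h1, h2]
    exact (hrib a b).step_one i n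
  · obtain ⟨a, b, h1, h2⟩ := key i n i (n + 2) (by simp) (by simp)
    rw [h1, h2]
    exact (hrib a b).step_two i n
  · obtain ⟨a, b, h1, h2⟩ := key i n (i + 1) n (by simp) (by simp)
    rw [h1, h2]
    exact (hrib a b).two_le_gap i n
  · obtain ⟨a, b, h1, h2⟩ := key i n (i + 1) n (by simp) (by simp)
    rw [h1, h2]
    exact (hrib a b).gap_le_four i n
  · rw [hcell a b, hr, add_sub_cancel_right, add_sub_cancel_right] <;>
      rw [add_sub_cancel_right] <;> omega

end Gluing

/-! ### Covers and their entropy -/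

section Covers

variable {Z : Type u} {X : Set Z} {T : ℤ × ℤ → Z → Z} {𝒰 𝒱 : Set (Set Z)}

theorem minCover_le {F : Finset (Set Z)} (hF : (F : Set (Set Z)) ⊆ 𝒱)
    (hX : X ⊆ ⋃₀ (F : Set (Set Z))) : minCover X 𝒱 ≤ F.card :=
  Nat.sInf_le ⟨F, hF, hX, rfl⟩

theorem exists_card_eq_minCover {F : Finset (Set Z)} (hF : (F : Set (Set Z)) ⊆ 𝒱)
    (hX : X ⊆ ⋃₀ (F : Set (Set Z))) :
    ∃ G : Finset (Set Z), (G : Set (Set Z)) ⊆ 𝒱 ∧ X ⊆ ⋃₀ (G : Set (Set Z)) ∧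
      G.card = minCover X 𝒱 :=
  Nat.sInf_mem (s := {k | ∃ F : Finset (Set Z), (F : Set (Set Z)) ⊆ 𝒱 ∧
    X ⊆ ⋃₀ (F : Set (Set Z)) ∧ F.card = k}) ⟨F.card, F, hF, hX, rfl⟩

theorem finite_coverJoin (T : ℤ × ℤ → Z → Z) (h𝒰 : 𝒰.Finite) (n : ℕ) :
    (coverJoin T 𝒰 n).Finite := by
  have : Finite 𝒰 := h𝒰
  have : Finite (Ico (0 : ℤ) n ×ˢ Ico (0 : ℤ) n) := ((finite_Ico _ _).prod (finite_Ico _ _))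
  refine (finite_range fun c : (Ico (0 : ℤ) n ×ˢ Ico (0 : ℤ) n) → 𝒰 =>
    {z | ∀ g, T g.1 z ∈ (c g).1}).subset ?_
  rintro P ⟨c, hc, rfl⟩
  exact ⟨fun g => ⟨c g, hc g⟩, by ext z; simp⟩

theorem exists_finset_coverJoin (T : ℤ × ℤ → Z → Z) (X : Set Z) (h𝒰 : 𝒰.Finite)
    (hcover : ⋃₀ 𝒰 = univ) (n : ℕ) :
    ∃ F : Finset (Set Z), (F : Set (Set Z)) ⊆ coverJoin T 𝒰 n ∧ X ⊆ ⋃₀ (F : Set (Set Z)) := by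
  refine ⟨(finite_coverJoin T h𝒰 n).toFinset, by simp, fun z _ => ?_⟩
  have h : ∀ g, ∃ U ∈ 𝒰, T g z ∈ U := fun g => by
    have : T g z ∈ ⋃₀ 𝒰 := hcover ▸ mem_univ _
    exact this
  choose c hc hz using h
  exact ⟨{z | ∀ g ∈ Ico (0 : ℤ) n ×ˢ Ico (0 : ℤ) n, T g z ∈ c g},
    by simpa only [Finite.coe_toFinset] using ⟨c, hc, rfl⟩, fun g _ => hz g⟩

/-- A family of points, no two of which share an element of the cover, bounds the size of
subcovers from below. -/
theorem card_le_minCover {ι : Type*} [Fintype ι] {F : Finset (Set Z)}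
    (hF : (F : Set (Set Z)) ⊆ 𝒱) (hX : X ⊆ ⋃₀ (F : Set (Set Z))) (z : ι → Z)
    (hz : ∀ i, z i ∈ X) (hsep : ∀ P ∈ 𝒱, ∀ i j, z i ∈ P → z j ∈ P → i = j) :
    Fintype.card ι ≤ minCover X 𝒱 := by
  obtain ⟨G, hG, hXG, hcard⟩ := exists_card_eq_minCover hF hX
  rw [← hcard, ← Fintype.card_coe]
  choose P hP hzP using fun i => hXG (hz i)
  refine Fintype.card_le_of_injective (fun i => (⟨P i, hP i⟩ : G)) fun i j hij => ?_
  have hij : P i = P j := congrArg Subtype.val hij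
  exact hsep (P i) (hG (hP i)) i j (hzP i) (hij ▸ hzP j)

theorem log_natCast_le {a b : ℕ} (h : a ≤ b) : Real.log a ≤ Real.log b := by
  rcases Nat.eq_zero_or_pos a with rfl | h0
  · rw [Nat.cast_zero, Real.log_zero]
    exact Real.log_natCast_nonneg _
  · exact Real.log_le_log (by exact_mod_cast h0) (by exact_mod_cast h)

theorem coverEntropy_le_of_minCover_le {Z' : Type v} {X' : Set Z'} {T' : ℤ × ℤ → Z' → Z'}
    {𝒰' : Set (Set Z')}
    (h : ∀ n, minCover X (coverJoin T 𝒰 n) ≤ minCover X' (coverJoin T' 𝒰' n)) :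
    coverEntropy T X 𝒰 ≤ coverEntropy T' X' 𝒰' := by
  refine limsup_le_limsup (Eventually.of_forall fun n => EReal.coe_le_coe_iff.2 ?_)
  exact div_le_div_of_nonneg_right (log_natCast_le (h n)) (by positivity)

theorem coverEntropy_nonpos {C : ℕ}
    (h : ∀ n, 1 ≤ n → minCover X (coverJoin T 𝒰 n) ≤ C) : coverEntropy T X 𝒰 ≤ 0 := by
  have hlim : Tendsto (fun n : ℕ => ((Real.log C / (n : ℝ) ^ 2 : ℝ) : EReal)) atTop (𝓝 0) := by
    rw [← EReal.coe_zero, EReal.tendsto_coe]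
    exact tendsto_const_nhds.div_atTop
      ((tendsto_pow_atTop two_ne_zero).comp tendsto_natCast_atTop_atTop)
  rw [← hlim.limsup_eq]
  refine limsup_le_limsup ((eventually_ge_atTop 1).mono fun n hn => EReal.coe_le_coe_iff.2 ?_)
  exact div_le_div_of_nonneg_right (log_natCast_le (h n hn)) (by positivity)

theorem coverEntropy_pos {c : ℝ} (hc : 0 < c)
    (h : ∃ᶠ n : ℕ in atTop, c ≤ Real.log (minCover X (coverJoin T 𝒰 n)) / (n : ℝ) ^ 2) :
    0 < coverEntropy T X 𝒰 :=
  (EReal.coe_pos.2 hc).trans_le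
    (le_limsup_of_frequently_le (h.mono fun _ hn => EReal.coe_le_coe_iff.2 hn))

theorem sUnion_pair_compl_eq_univ {K K' : Set Z} (h : Disjoint K K') :
    ⋃₀ {Kᶜ, K'ᶜ} = (univ : Set Z) := by
  rw [sUnion_pair, ← compl_inter, h.inter_eq, compl_empty]

end Covers

/-! ### Entropy pairs of fabrics come from transitivity pairs -/

section EntropyPairs

variable {A : Type u} [TopologicalSpace A] [DiscreteTopology A]

theorem isClosed_setOf_not_appearsIn (v : Pattern A) :
    IsClosed {z : Config A | ¬ v.AppearsIn z} := by
  refine isOpen_compl_iff.1 ?_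
  have : {z : Config A | ¬ v.AppearsIn z}ᶜ = ⋃ g, ⋂ s : v.supp, {z | z (s.1 + g) = v.val s} := by
    ext z
    simp [Pattern.AppearsIn]
  rw [this]
  refine isOpen_iUnion fun g => isOpen_iInter_of_finite fun s => ?_
  exact (isOpen_discrete {v.val s}).preimage
    (show Continuous fun z : Config A => z (s.1 + g) from continuous_apply _)

/-- The fabrics that carry an occurrence of the pattern `v` contain a closed neighbourhood of each
of them. -/
theorem exists_isClosed_nhds_appearsIn [Finite A] {W : Set (Config A)} (hW : IsSubshift W)
    {v : Pattern A} {x : Config A} {y : Config (Symbol A)} (hv : v.AppearsIn x)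
    (hx : x ∈ W) (hy : y ∈ fabric x) :
    ∃ K, IsClosed K ∧ K ∈ 𝓝[fabricSet W] y ∧
      ∀ u ∈ K, ∀ z, u ∈ fabric z → v.AppearsIn z := by
  have hsub : IsSubshift (W ∩ {z | ¬ v.AppearsIn z}) :=
    ⟨hW.isClosed.inter (isClosed_setOf_not_appearsIn v),
      fun g z hz => ⟨hW.shift_mem g z hz.1, fun h => hz.2 h.of_shift⟩⟩
  have hcl := (isSubshift_fabricSet hsub).isClosed
  have hyn : y ∈ (fabricSet (W ∩ {z | ¬ v.AppearsIn z}))ᶜ := fun h => by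
    obtain ⟨z, hz, hyz⟩ := mem_fabricSet.1 h
    obtain ⟨k, rfl⟩ := exists_eq_shift_of_mem_fabric hyz hy
    exact hz.2 hv.of_shift
  obtain ⟨K, hK, hKc, hKs⟩ := exists_mem_nhds_isClosed_subset (hcl.isOpen_compl.mem_nhds hyn)
  refine ⟨K ∩ fabricSet W, hKc.inter (isSubshift_fabricSet hW).isClosed,
    inter_mem (mem_nhdsWithin_of_mem_nhds hK) self_mem_nhdsWithin, fun u hu z huz => ?_⟩
  by_contra hn
  obtain ⟨w, hw, huw⟩ := mem_fabricSet.1 hu.2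
  obtain ⟨k, rfl⟩ := exists_eq_shift_of_mem_fabric huw huz
  refine hKs hu.1 (mem_fabricSet.2 ⟨_, ⟨hW.shift_mem k w hw, hn⟩, huz⟩)

/-- If `v` and `v'` never coexist, no orbit in `f(W)` visits both neighbourhoods, so each orbit lies
entirely in one of the two complements. Two elements of every iterated cover suffice. -/
theorem mem_transitivityPairs_of_isEntropyPair [Finite A] {W : Set (Config A)}
    (hW : IsSubshift W) {x x' : Config A} {y y' : Config (Symbol A)} (hx : x ∈ W) (hx' : x' ∈ W)
    (hy : y ∈ fabric x) (hy' : y' ∈ fabric x') (h : IsEntropyPair (fabricSet W) y y') :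
    (x, x') ∈ transitivityPairs W := by
  refine ⟨hx, hx', fun v v' hv hv' => ?_⟩
  by_contra! hne
  obtain ⟨K, hKc, hK, hKv⟩ := exists_isClosed_nhds_appearsIn hW hv hx hy
  obtain ⟨K', hKc', hK', hKv'⟩ := exists_isClosed_nhds_appearsIn hW hv' hx' hy'
  have horb : ∀ u ∈ fabricSet W, ∀ g g', shift g u ∈ K → shift g' u ∈ K' → False := by
    intro u hu g g' h1 h2
    obtain ⟨z, hz, huz⟩ := mem_fabricSet.1 hu
    exact hne z hz (hKv _ h1 z (shift_mem_fabric g huz)) (hKv' _ h2 z (shift_mem_fabric g' huz))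
  have hsub : K ∩ fabricSet W ∈ 𝓝[fabricSet W] y := inter_mem hK self_mem_nhdsWithin
  have hXc := (isSubshift_fabricSet hW).isClosed
  -- Incompatibility is known only for points of `f(W)`, whereas disjointness is required among all
  -- configurations; hence the intersection.
  have hdisj : Disjoint (K ∩ fabricSet W) K' := by
    rw [Set.disjoint_left]
    rintro u ⟨hu, huW⟩ hu'
    exact horb u huW 0 0 (by rwa [shift_zero]) (by rwa [shift_zero])
  refine (h.2.2.2 _ _ (hKc.inter hXc) hKc' hsub hK' hdisj).not_ge
    (coverEntropy_nonpos (C := 2) fun n _ => ?_)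
  classical
  let P : Set (Config (Symbol A)) → Set (Config (Symbol A)) := fun c =>
    {u | ∀ g ∈ Ico (0 : ℤ) n ×ˢ Ico (0 : ℤ) n, shift g u ∈ c}
  refine (minCover_le (F := {P (K ∩ fabricSet W)ᶜ, P K'ᶜ}) ?_ fun u hu => ?_).trans
    Finset.card_le_two
  · rintro Q hQ
    simp only [Finset.coe_insert, Finset.coe_singleton, mem_insert_iff, mem_singleton_iff] at hQ
    rcases hQ with rfl | rfl
    exacts [⟨fun _ => _, fun _ => Or.inl rfl, rfl⟩, ⟨fun _ => _, fun _ => Or.inr rfl, rfl⟩]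
  · by_cases hg : ∃ g, shift g u ∈ K
    · obtain ⟨g, hg⟩ := hg
      exact ⟨P K'ᶜ, by simp, fun g' _ hg' => horb u hu g g' hg hg'⟩
    · exact ⟨P (K ∩ fabricSet W)ᶜ, by simp, fun g' _ hg' => hg ⟨g', hg'.1⟩⟩

end EntropyPairs

/-! ### Transitivity pairs yield entropy pairs -/

section Density

variable {A : Type u} [TopologicalSpace A]

/-- Some point of `W` visits the open set `U` along a positive proportion of the sites of a
lattice. -/
theorem exists_le_card_filter_shift_mem {W : Set (Config A)} (hμ : HasFullySupportedMeasure W)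
    {U : Set (Config A)} (hU : IsOpen U) (hUW : (U ∩ W).Nonempty) :
    ∃ δ : ℝ, 0 < δ ∧ ∀ (L : ℤ) (m : ℕ), ∃ z ∈ W, ∃ G : Finset (ℤ × ℤ),
      (∀ a ∈ G, a ∈ Ico (0 : ℤ) m ×ˢ Ico (0 : ℤ) m ∧ shift (L * a.1, L * a.2) z ∈ U) ∧
      δ * (m : ℝ) ^ 2 ≤ G.card := by
  classical
  let _ : MeasurableSpace (Config A) := borel (Config A)
  have : BorelSpace (Config A) := ⟨rfl⟩
  obtain ⟨μ, hprob, hinv, hnull, hpos⟩ := hμ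
  have hU0 := hpos U hU hUW
  refine ⟨(μ U).toReal, ENNReal.toReal_pos hU0.ne' (measure_ne_top _ _), fun L m => ?_⟩
  let B : Finset (ℤ × ℤ) := Finset.Ico (0 : ℤ) m ×ˢ Finset.Ico (0 : ℤ) m
  let S : ℤ × ℤ → Set (Config A) := fun a => shift (L * a.1, L * a.2) ⁻¹' U
  have hS : ∀ a, MeasurableSet (S a) := fun a =>
    (hU.preimage (continuous_shift _)).measurableSet
  have hμS : ∀ a, μ (S a) = μ U := fun a => by
    rw [← Measure.map_apply (continuous_shift _).measurable hU.measurableSet, hinv]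
  have hint : ∫⁻ z, ∑ a ∈ B, (S a).indicator 1 z ∂μ = (m : ENNReal) ^ 2 * μ U := by
    rw [lintegral_finsetSum _ fun a _ => measurable_one.indicator (hS a)]
    simp only [lintegral_indicator_one (hS _), hμS, Finset.sum_const, nsmul_eq_mul]
    simp [B, sq]
  have hfin : (m : ENNReal) ^ 2 * μ U ≠ ⊤ :=
    ENNReal.mul_ne_top (ENNReal.pow_ne_top (ENNReal.natCast_ne_top m)) (measure_ne_top _ _)
  -- By invariance the mean number of visits is `m ^ 2 * μ U`, and some point of `W` does at least
  -- as well as the mean.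
  obtain ⟨z, hz, hle⟩ := exists_notMem_null_lintegral_le (hint ▸ hfin) hnull
  refine ⟨z, not_not.1 hz, B.filter fun a => z ∈ S a, fun a ha => ?_, ?_⟩
  · rw [Finset.mem_filter, Finset.mem_product, Finset.mem_Ico, Finset.mem_Ico] at ha
    exact ⟨ha.1, ha.2⟩
  · have hsum : ∑ a ∈ B, (S a).indicator (1 : Config A → ENNReal) z =
        ((B.filter fun a => z ∈ S a).card : ENNReal) := by
      simp [Set.indicator_apply, Finset.sum_boole]
    rw [hint, hsum] at hle
    have := ENNReal.toReal_mono (ENNReal.natCast_ne_top _) hle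
    rw [ENNReal.toReal_mul, ENNReal.toReal_pow, ENNReal.toReal_natCast,
      ENNReal.toReal_natCast] at this
    rwa [mul_comm]

theorem exists_box_subset_of_mem_nhds {B : Type u} [TopologicalSpace B] [DiscreteTopology B]
    {y : Config B} {U : Set (Config B)} (hU : U ∈ 𝓝 y) :
    ∃ N : ℤ, ∀ u : Config B, (∀ n m, |n| ≤ N → |m| ≤ N → y (n, m) = u (n, m)) → u ∈ U := by
  obtain ⟨O, hOU, hO, hyO⟩ := mem_nhds_iff.1 hU
  obtain ⟨I, s, hs, hsub⟩ := isOpen_pi_iff.1 hO y hyO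
  obtain ⟨N, hN⟩ := ((I.finite_toSet.image fun p => max |p.1| |p.2|)).bddAbove
  refine ⟨N, fun u hu => hOU (hsub fun p hp => ?_)⟩
  have h1 : max |p.1| |p.2| ≤ N := hN (mem_image_of_mem _ hp)
  rw [← hu p.1 p.2 ((le_max_left _ _).trans h1) ((le_max_right _ _).trans h1)]
  exact (hs p hp).2

end Density

/-! ### Independent choices on the fabric and positive entropy -/

section Independence

variable {A : Type u}

/-- The two fabrics `y` and `y'` can be printed independently at all sites of `G`. -/
theorem exists_independent_weaves {H V H' V' : ℤ → ℤ → ℤ} {x x' : Config A}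
    {y y' : Config (Symbol A)} (hH : IsRibbonFamily H) (hV : IsRibbonFamily V)
    (hH' : IsRibbonFamily H') (hV' : IsRibbonFamily V') (hy : IsWeave H V x y)
    (hy' : IsWeave H' V' x' y') (N I : ℤ) (hI : 2 * N + |H 0 0| + |V 0 0| + 4 ≤ I)
    (hI' : 2 * N + |H' 0 0| + |V' 0 0| + 4 ≤ I) (k : ℤ × ℤ) :
    ∃ L : ℤ, 0 < L ∧ ∀ (z : Config A) (G : Set (ℤ × ℤ)),
      (∀ a ∈ G, ∀ j i, |j| ≤ I → |i| ≤ I →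
        x (j, i) = shift (L * a.1, L * a.2) z (j, i) ∧
        x' (j, i) = shift (L * a.1, L * a.2) z ((j, i) + k)) →
      ∀ s : Set (ℤ × ℤ), ∃ u ∈ fabric z, ∀ a ∈ G, ∀ n m, |n| ≤ N → |m| ≤ N →
        (a ∉ s → y (n, m) = shift (3 * L * a.1, 3 * L * a.2) u (n, m)) ∧
        (a ∈ s → y' (n, m) = shift (3 * L * a.1, 3 * L * a.2) u (n, m)) := by
  classical
  -- The box must contain the labels needed by `y` and also those needed by `y'` after displacement
  -- by `k`.
  set J := |I| + |k.1| + |k.2| with hJ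
  obtain ⟨M₁, H₁, hH₁, hHH, hH₁0⟩ := hH.exists_truncate J
  obtain ⟨M₂, V₁, hV₁, hVV, hV₁0⟩ := hV.exists_truncate J
  -- Ribbon `i` of `y'` receives label `i + k.2`, so that the ribbons drawn near the centre of the
  -- cell are those on which `z` shows `x'`.
  obtain ⟨M₃, H₂, hH₂, hHH', hH₂0⟩ := (hH'.translate (-k.2) 0 0).exists_truncate J
  obtain ⟨M₄, V₂, hV₂, hVV', hV₂0⟩ := (hV'.translate (-k.1) 0 0).exists_truncate J
  obtain ⟨M, hM₁, hM₂, hM₃, hM₄, hMJ⟩ : ∃ M, M₁ ≤ M ∧ M₂ ≤ M ∧ M₃ ≤ M ∧ M₄ ≤ M ∧ J ≤ M :=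
    ⟨max (max (max M₁ M₂) (max M₃ M₄)) J, by omega, by omega, by omega, by omega, by omega⟩
  have hI0 := le_abs_self I
  have hI1 := abs_nonneg I
  have hk1 := abs_nonneg k.1
  have hk2 := abs_nonneg k.2
  refine ⟨2 * M + 5, by omega, fun z G hG s => ?_⟩
  set L := 2 * M + 5 with hL
  obtain ⟨P, hP, hPeq⟩ := exists_isRibbonFamily_glue (M := M) (L := L) (by omega) (by omega)
    -- The signs come from the convention `shift g x h = x (h - g)`: site `a` uses the cell at `-a`.
    -- The swap occurs because the label of a horizontal ribbon is its second coordinate.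
    (R := fun a b => if (-b, -a) ∈ s then H₂ else H₁)
    (fun a b => by
      split_ifs
      exacts [hH₂, hH₁])
    (fun a b i n h => by
      split_ifs
      exacts [hH₂0 i n (by omega), hH₁0 i n (by omega)])
  obtain ⟨Q, hQ, hQeq⟩ := exists_isRibbonFamily_glue (M := M) (L := L) (by omega) (by omega)
    (R := fun a b => if (-a, -b) ∈ s then V₂ else V₁)
    (fun a b => by
      split_ifs
      exacts [hV₂, hV₁])
    (fun a b i n h => by
      split_ifs
      exacts [hV₂0 i n (by omega), hV₁0 i n (by omega)])
  obtain ⟨u, hu⟩ := exists_isWeave hP hQ z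
  refine ⟨u, ⟨P, Q, hP, hQ, hu⟩, fun a ha n m hn hm => ⟨fun has => ?_, fun has => ?_⟩⟩
  · have hw := hu.translate (3 * L * -a.1, 3 * L * -a.2) (L * -a.1, L * -a.2)
    have e := hy.eq_of_agree hH hV (hP.translate _ _ _) (hQ.translate _ _ _) hw hI
      (fun i n hi hn => ?_) (fun j m hj hm => ?_) (fun j i hj hi => ?_) hn hm
    · rw [e, shift]
      congr 1
      ext <;> simp <;> ring
    · simp only
      rw [hPeq _ _ i n (by omega) (by omega), neg_neg, neg_neg, if_neg has,
        hHH i n (by omega) (by omega)]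
      ring
    · simp only
      rw [hQeq _ _ j m (by omega) (by omega), neg_neg, neg_neg, if_neg has,
        hVV j m (by omega) (by omega)]
      ring
    · rw [(hG a ha j i hj hi).1, shift]
      congr 1
      ext <;> simp <;> ring
  · have hw := hu.translate (3 * L * -a.1, 3 * L * -a.2) (k.1 + L * -a.1, k.2 + L * -a.2)
    have e := hy'.eq_of_agree hH' hV' (hP.translate _ _ _) (hQ.translate _ _ _) hw hI'
      (fun i n hi hn => ?_) (fun j m hj hm => ?_) (fun j i hj hi => ?_) hn hm
    · rw [e, shift]
      congr 1
      ext <;> simp <;> ring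
    · have := abs_add_le i k.2
      simp only
      rw [← add_assoc, hPeq _ _ (i + k.2) n (by omega) (by omega), neg_neg, neg_neg, if_pos has,
        hHH' (i + k.2) n (by omega) (by omega)]
      simp
    · have := abs_add_le j k.1
      simp only
      rw [← add_assoc, hQeq _ _ (j + k.1) m (by omega) (by omega), neg_neg, neg_neg, if_pos has,
        hVV' (j + k.1) m (by omega) (by omega)]
      simp
    · rw [(hG a ha j i hj hi).2, shift]
      congr 1
      ext <;> simp <;> ring

variable [TopologicalSpace A] [DiscreteTopology A]

/-- At a positive proportion of lattice sites one may choose freely between visiting `K` and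
visiting `K'`; exponentially many choices are separated by the cover. -/
theorem isEntropyPair_of_mem_transitivityPairs [Finite A] {W : Set (Config A)}
    (hW : IsSubshift W) (hμ : HasFullySupportedMeasure W) {x x' : Config A}
    {y y' : Config (Symbol A)} (hx : (x, x') ∈ transitivityPairs W) (hy : y ∈ fabric x)
    (hy' : y' ∈ fabric x') (hne : y ≠ y') : IsEntropyPair (fabricSet W) y y' := by
  classical
  refine ⟨mem_fabricSet.2 ⟨x, hx.1, hy⟩, mem_fabricSet.2 ⟨x', hx.2.1, hy'⟩, hne,
    fun K K' _ _ hK hK' hdisj => ?_⟩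
  obtain ⟨H, V, hH, hV, hy⟩ := hy
  obtain ⟨H', V', hH', hV', hy'⟩ := hy'
  obtain ⟨O, hO, hOK⟩ := mem_nhdsWithin_iff_exists_mem_nhds_inter.1 hK
  obtain ⟨O', hO', hOK'⟩ := mem_nhdsWithin_iff_exists_mem_nhds_inter.1 hK'
  obtain ⟨N₁, hN₁⟩ := exists_box_subset_of_mem_nhds hO
  obtain ⟨N₂, hN₂⟩ := exists_box_subset_of_mem_nhds hO'
  set N := max N₁ N₂
  obtain ⟨I, hI, hI'⟩ : ∃ I, 2 * N + |H 0 0| + |V 0 0| + 4 ≤ I ∧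
      2 * N + |H' 0 0| + |V' 0 0| + 4 ≤ I :=
    ⟨_, le_max_left _ _, le_max_right _ _⟩
  let F : Finset (ℤ × ℤ) := Finset.Icc (-I) I ×ˢ Finset.Icc (-I) I
  have hF : ∀ j i, |j| ≤ I → |i| ≤ I → (j, i) ∈ F := fun j i hj hi => by
    rw [Finset.mem_product, Finset.mem_Icc, Finset.mem_Icc]
    exact ⟨abs_le.1 hj, abs_le.1 hi⟩
  obtain ⟨z₀, hz₀, ⟨g, hg⟩, ⟨g', hg'⟩⟩ := hx.2.2 ⟨F, fun s => x s.1⟩ ⟨F, fun s => x' s.1⟩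
    ⟨0, fun s => by simp⟩ ⟨0, fun s => by simp⟩
  set k := g' - g with hk
  -- `U` asks for the central pattern of `x` at the origin and that of `x'` at offset `k`; a shift
  -- of `z₀` shows that it meets `W`.
  let U : Set (Config A) := ⋂ p ∈ F, {w | w p = x p} ∩ {w | w (p + k) = x' p}
  have hU : IsOpen U := isOpen_biInter_finset fun p _ =>
    ((isOpen_discrete {x p}).preimage (f := fun w : Config A => w p) (continuous_apply p)).inter
      ((isOpen_discrete {x' p}).preimage (f := fun w : Config A => w (p + k))
        (continuous_apply (p + k)))
  have hUW : (U ∩ W).Nonempty := by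
    refine ⟨shift (-g) z₀, mem_iInter₂.2 fun p hp => ⟨?_, ?_⟩, hW.shift_mem _ _ hz₀⟩
    · have := hg ⟨p, hp⟩
      simp only [mem_ofPred_eq, shift, sub_neg_eq_add]
      exact this
    · have := hg' ⟨p, hp⟩
      simp only [mem_ofPred_eq, shift, sub_neg_eq_add, hk]
      rw [add_assoc, sub_add_cancel]
      exact this
  obtain ⟨δ, hδ, hdens⟩ := exists_le_card_filter_shift_mem hμ hU hUW
  obtain ⟨L, hL, hind⟩ := exists_independent_weaves hH hV hH' hV' hy hy' N I hI hI' k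
  have hLR : (0 : ℝ) < L := by exact_mod_cast hL
  have hlog : 0 < Real.log 2 := Real.log_pos one_lt_two
  -- A window of side `3 * L * m` has at least `δ * m ^ 2` binary choices and area `9 * L ^ 2 * m ^
  -- 2`.
  refine coverEntropy_pos (c := δ * Real.log 2 / (9 * (L : ℝ) ^ 2)) (by positivity) ?_
  refine frequently_atTop.2 fun n₀ => ?_
  obtain ⟨m, hm⟩ : ∃ m : ℕ, m = n₀ + 1 := ⟨_, rfl⟩
  have hLn : ((L.toNat : ℕ) : ℤ) = L := Int.toNat_of_nonneg hL.le
  refine ⟨3 * L.toNat * m, ?_, ?_⟩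
  · have : 1 ≤ L.toNat := by omega
    nlinarith
  obtain ⟨z, hz, G, hG, hcard⟩ := hdens L m
  have hind := hind z G fun a ha j i hj hi => by
    have := mem_iInter₂.1 (hG a ha).2 (j, i) (hF j i hj hi)
    exact ⟨this.1.symm, this.2.symm⟩
  choose u hu hpat using hind
  have hX := isSubshift_fabricSet hW
  have huX : ∀ s, u s ∈ fabricSet W := fun s => mem_fabricSet.2 ⟨z, hz, hu s⟩
  have huK : ∀ s, ∀ a ∈ G, a ∉ s → shift (3 * L * a.1, 3 * L * a.2) (u s) ∈ K :=
    fun s a ha has => hOK ⟨hN₁ _ fun n m hn hm => (hpat s a ha n m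
      (hn.trans (le_max_left _ _)) (hm.trans (le_max_left _ _))).1 has, hX.shift_mem _ _ (huX s)⟩
  have huK' : ∀ s, ∀ a ∈ G, a ∈ s → shift (3 * L * a.1, 3 * L * a.2) (u s) ∈ K' :=
    fun s a ha has => hOK' ⟨hN₂ _ fun n m hn hm => (hpat s a ha n m
      (hn.trans (le_max_right _ _)) (hm.trans (le_max_right _ _))).2 has, hX.shift_mem _ _ (huX s)⟩
  obtain ⟨F₀, hF₀, hXF₀⟩ := exists_finset_coverJoin shift (fabricSet W)
    (toFinite {Kᶜ, K'ᶜ}) (sUnion_pair_compl_eq_univ hdisj) (3 * L.toNat * m)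
  have hpow := card_le_minCover (ι := G.powerset) hF₀ hXF₀ (fun s => u s.1)
    (fun s => huX _) (by
      rintro P ⟨c, hc, rfl⟩ ⟨s, hs⟩ ⟨t, ht⟩ hus hut
      rw [Finset.mem_powerset] at hs ht
      -- At a site of `s` outside `t`, the fabric of `s` visits `K'` and that of `t` visits `K`, so
      -- neither complement contains both.
      have hsep : ∀ s t : Finset (ℤ × ℤ), ∀ a ∈ G, a ∈ s → a ∉ t →
          (∀ g ∈ Ico (0 : ℤ) (3 * L.toNat * m : ℕ) ×ˢ Ico (0 : ℤ) (3 * L.toNat * m : ℕ),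
            shift g (u s) ∈ c g) →
          (∀ g ∈ Ico (0 : ℤ) (3 * L.toNat * m : ℕ) ×ˢ Ico (0 : ℤ) (3 * L.toNat * m : ℕ),
            shift g (u t) ∈ c g) → False := by
        intro s t a ha has hat h1 h2
        have hmem : (3 * L * a.1, 3 * L * a.2) ∈
            Ico (0 : ℤ) (3 * L.toNat * m : ℕ) ×ˢ Ico (0 : ℤ) (3 * L.toNat * m : ℕ) := by
          obtain ⟨⟨h3, h4⟩, h5, h6⟩ := (hG a ha).1
          push_cast
          rw [hLn]
          refine ⟨⟨by positivity, ?_⟩, ⟨by positivity, ?_⟩⟩ <;> simp only <;> gcongr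
        have hKs := huK' s a ha has
        have hKt := huK t a ha hat
        rcases hc (3 * L * a.1, 3 * L * a.2) with h | h
        · exact (h ▸ h2 _ hmem) hKt
        · exact (h ▸ h1 _ hmem) hKs
      refine Subtype.ext (Finset.ext fun a => ⟨fun has => ?_, fun hat => ?_⟩)
      · by_contra hat
        exact hsep s t a (hs has) has hat hus hut
      · by_contra has
        exact hsep t s a (ht hat) hat has hut hus)
  rw [Fintype.card_coe, Finset.card_powerset] at hpow
  have h1 := log_natCast_le hpow
  rw [Nat.cast_pow, Real.log_pow, Nat.cast_ofNat] at h1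
  have h2 : ((3 * L.toNat * m : ℕ) : ℝ) = 3 * L * m := by
    have : ((L.toNat : ℕ) : ℝ) = L := by exact_mod_cast hLn
    push_cast
    rw [this]
  have hmR : (0 : ℝ) < m := by
    rw [hm]
    positivity
  rw [h2, div_le_div_iff₀ (by positivity) (by positivity)]
  have h3 : δ * (m : ℝ) ^ 2 * Real.log 2 ≤
      Real.log (minCover (fabricSet W) (coverJoin shift {Kᶜ, K'ᶜ} (3 * L.toNat * m))) :=
    (mul_le_mul_of_nonneg_right hcard hlog.le).trans h1
  calc δ * Real.log 2 * (3 * L * m) ^ 2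
      = δ * (m : ℝ) ^ 2 * Real.log 2 * (9 * (L : ℝ) ^ 2) := by ring
    _ ≤ _ := mul_le_mul_of_nonneg_right h3 (by positivity)

/-- The fabric map matches transitivity pairs with entropy-or-equal pairs. -/
theorem fabricRel_transitivityPairs [Finite A] {W : Set (Config A)} (hW : IsSubshift W)
    (hμ : HasFullySupportedMeasure W) :
    fabricRel (transitivityPairs W) = entropyOrEqual (fabricSet W) := by
  ext ⟨y, y'⟩
  constructor
  · intro h
    obtain ⟨⟨x, x'⟩, hx, hy, hy'⟩ := mem_fabricRel.1 h
    refine ⟨mem_fabricSet.2 ⟨x, hx.1, hy⟩, mem_fabricSet.2 ⟨x', hx.2.1, hy'⟩, ?_⟩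
    rcases eq_or_ne y y' with he | hne
    · exact Or.inl he
    · exact Or.inr (isEntropyPair_of_mem_transitivityPairs hW hμ hx hy hy' hne)
  · rintro ⟨h1, h2, h⟩
    obtain ⟨x, hx, hy⟩ := mem_fabricSet.1 h1
    obtain ⟨x', hx', hy'⟩ := mem_fabricSet.1 h2
    rcases h with he | h
    · obtain rfl : y = y' := he
      exact mem_fabricRel.2 ⟨(x, x), hW.transitivityPairs.refl x hx, hy, hy⟩
    · exact mem_fabricRel.2 ⟨(x, x'),
        mem_transitivityPairs_of_isEntropyPair hW hx hx' hy hy' h, hy, hy'⟩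

end Independence

/-! ### Completely positive entropy -/

section Factors

variable {A : Type u} [TopologicalSpace A] {X : Set (Config A)}

theorem isClosed_setOf_factor_eq {Y : Type*} [TopologicalSpace Y] [T2Space Y] (hX : IsClosed X)
    {π : X → Y} (hπ : Continuous π) :
    IsClosed {p : Config A × Config A |
      ∃ (h : p.1 ∈ X) (h' : p.2 ∈ X), π ⟨p.1, h⟩ = π ⟨p.2, h'⟩} := by
  have hemb : IsClosedEmbedding (Prod.map ((↑) : X → Config A) ((↑) : X → Config A)) :=
    hX.isClosedEmbedding_subtypeVal.prodMap hX.isClosedEmbedding_subtypeVal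
  convert hemb.isClosedMap _ (isClosed_eq (hπ.comp continuous_fst) (hπ.comp continuous_snd)) using 1
  ext ⟨x, y⟩
  constructor
  · rintro ⟨h, h', he⟩
    exact ⟨(⟨x, h⟩, ⟨y, h'⟩), he, rfl⟩
  · rintro ⟨⟨a, b⟩, he, hab⟩
    obtain ⟨rfl, rfl⟩ := Prod.mk.inj hab
    exact ⟨a.2, b.2, he⟩

/-- Points of an entropy pair have the same image in every factor without entropy. -/
theorem IsEntropyPair.factor_eq {Y : Type u} [TopologicalSpace Y] [T3Space Y]
    [AddAction (ℤ × ℤ) Y] (hX : IsSubshift X) {π : X → Y} (hπ : Continuous π)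
    (heq : ∀ (g : ℤ × ℤ) (x x' : X), x'.1 = shift g x.1 → π x' = g +ᵥ π x)
    (hY : ¬ 0 < topEntropy Y) {x y : Config A} (h : IsEntropyPair X x y) :
    π ⟨x, h.1⟩ = π ⟨y, h.2.1⟩ := by
  classical
  by_contra hne
  obtain ⟨O, O', hO, hO', hxO, hyO', hdisj⟩ := t2_separation hne
  obtain ⟨B, hB, hBc, hBO⟩ := exists_mem_nhds_isClosed_subset (hO.mem_nhds hxO)
  obtain ⟨B', hB', hBc', hBO'⟩ := exists_mem_nhds_isClosed_subset (hO'.mem_nhds hyO')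
  have hBB : Disjoint B B' := hdisj.mono hBO hBO'
  have hclosed : ∀ {B : Set Y}, IsClosed B → IsClosed (((↑) : X → Config A) '' (π ⁻¹' B)) :=
    fun hB => hX.isClosed.isClosedEmbedding_subtypeVal.isClosedMap _ (hB.preimage hπ)
  have hnhds : ∀ {B : Set Y} {x : X}, B ∈ 𝓝 (π x) →
      ((↑) : X → Config A) '' (π ⁻¹' B) ∈ 𝓝[X] x.1 := fun {B x} hB => by
    rw [nhdsWithin_eq_map_subtype_coe x.2]
    exact image_mem_map (hπ.continuousAt hB)
  have hpos := h.2.2.2 _ _ (hclosed hBc) (hclosed hBc') (hnhds (x := ⟨x, h.1⟩) hB)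
    (hnhds (x := ⟨y, h.2.1⟩) hB')
    ((disjoint_image_iff Subtype.val_injective).2 (hBB.preimage π))
  set K := ((↑) : X → Config A) '' (π ⁻¹' B) with hK
  set K' := ((↑) : X → Config A) '' (π ⁻¹' B') with hK'
  have hle : coverEntropy shift X {Kᶜ, K'ᶜ} ≤
      coverEntropy (fun (g : ℤ × ℤ) (y : Y) => g +ᵥ y) univ {Bᶜ, B'ᶜ} := by
    refine coverEntropy_le_of_minCover_le fun n => ?_
    have hlift : ∀ P ∈ coverJoin (fun (g : ℤ × ℤ) (y : Y) => g +ᵥ y) {Bᶜ, B'ᶜ} n,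
        ∃ Q ∈ coverJoin shift {Kᶜ, K'ᶜ} n, ∀ z : X, π z ∈ P → z.1 ∈ Q := by
      rintro P ⟨c, hc, rfl⟩
      -- An element of the cover downstairs is lifted by remembering which of the two sets it
      -- selects at each `g`.
      refine ⟨_, ⟨fun g => if c g = Bᶜ then Kᶜ else K'ᶜ, fun g => ?_, rfl⟩, fun z hz g hg => ?_⟩
      · beta_reduce
        split_ifs
        exacts [Or.inl rfl, Or.inr rfl]
      · have hzg := hz g hg
        have hval : ∀ w : X, w.1 = shift g z.1 → π w ∈ c g := fun w hw => by
          rw [heq g z w hw]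
          exact hzg
        beta_reduce
        split_ifs with hcg
        · rintro ⟨w, hw, hwz⟩
          exact (hcg ▸ hval w hwz) hw
        · rintro ⟨w, hw, hwz⟩
          exact ((hc g).resolve_left hcg ▸ hval w hwz) hw
    choose! Φ hΦ hΦ' using hlift
    obtain ⟨F₀, hF₀, hcov₀⟩ := exists_finset_coverJoin (fun (g : ℤ × ℤ) (y : Y) => g +ᵥ y) univ
      (toFinite {Bᶜ, B'ᶜ}) (sUnion_pair_compl_eq_univ hBB) n
    obtain ⟨F, hF, hcov, hcard⟩ := exists_card_eq_minCover hF₀ hcov₀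
    rw [← hcard]
    refine (minCover_le (F := F.image Φ) ?_ fun z hz => ?_).trans Finset.card_image_le
    · rintro Q hQ
      obtain ⟨P, hP, rfl⟩ := Finset.mem_image.1 hQ
      exact hΦ P (hF hP)
    · obtain ⟨P, hP, hzP⟩ := hcov (mem_univ (π ⟨z, hz⟩))
      exact ⟨Φ P, Finset.mem_image_of_mem Φ hP, hΦ' P (hF hP) ⟨z, hz⟩ hzP⟩
  refine hY (hpos.trans_le (hle.trans (le_iSup (fun 𝒰 : {𝒰 : Set (Set Y) //
    (∀ U ∈ 𝒰, IsOpen U) ∧ ⋃₀ 𝒰 = univ} =>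
      coverEntropy (fun (g : ℤ × ℤ) (y : Y) => g +ᵥ y) univ 𝒰.1)
      ⟨{Bᶜ, B'ᶜ}, ?_, sUnion_pair_compl_eq_univ hBB⟩)))
  rintro U (rfl | rfl)
  exacts [hBc.isOpen_compl, hBc'.isOpen_compl]

/-- If the hierarchy of entropy pairs exhausts `X²`, then `X` has completely positive entropy. -/
theorem hasTCPE_of_E_eq (hX : IsSubshift X) {α : Ordinal.{0}} (h : E X α = X ×ˢ X) :
    HasTCPE X := by
  intro Y _ _ _ _ _ π hπ hsurj heq hnt
  by_contra hY
  set N : Set (Config A × Config A) :=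
    {p | ∃ (h : p.1 ∈ X) (h' : p.2 ∈ X), π ⟨p.1, h⟩ = π ⟨p.2, h'⟩} with hN
  have hNc : IsClosed N := isClosed_setOf_factor_eq hX.isClosed hπ
  have hbase : entropyOrEqual X ⊆ N := by
    rintro ⟨x, y⟩ ⟨hx, hy, hxy⟩
    refine ⟨hx, hy, ?_⟩
    rcases hxy with hxy | hxy
    · obtain rfl : x = y := hxy
      rfl
    · exact hxy.factor_eq hX hπ heq hY
  have hstep : ∀ R, R ⊆ N → entropyStep X R ⊆ N := fun R hR => by
    unfold entropyStep
    split_ifs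
    · exact hR
    · rintro ⟨x, y⟩ hxy
      replace hxy : Relation.TransGen (Relation.SymmGen fun a b => (a, b) ∈ R) x y := hxy
      have hsymm : ∀ a b, Relation.SymmGen (fun a b => (a, b) ∈ R) a b → (a, b) ∈ N := by
        rintro a b (hab | hab)
        · exact hR hab
        · obtain ⟨h1, h2, h3⟩ := hR hab
          exact ⟨h2, h1, h3.symm⟩
      induction hxy with
      | single hab => exact hsymm _ _ hab
      | tail _ hbc ih =>
        obtain ⟨h1, h2, h3⟩ := ih
        obtain ⟨h4, h5, h6⟩ := hsymm _ _ hbc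
        exact ⟨h1, h5, h3.trans h6⟩
    · exact closure_minimal hR hNc
  have hE : E X α ⊆ N := by
    refine levels_induction (Q := fun α => E X α ⊆ N) ?_ ?_ ?_ ?_ α
    · rwa [E, levels_zero]
    · rwa [E, levels_one]
    · intro α hα ih
      rw [E, levels_add_one hα]
      exact hstep _ ih
    · intro α hα ih
      rw [E, levels_limit hα]
      exact iUnion_subset fun β => ih β.1 β.2
  obtain ⟨a, b, hab⟩ := exists_pair_ne Y
  obtain ⟨x, rfl⟩ := hsurj a
  obtain ⟨x', rfl⟩ := hsurj b
  obtain ⟨_, _, he⟩ := hE (h ▸ ⟨x.2, x'.2⟩ : (x.1, x'.1) ∈ E X α)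
  exact hab he

/-- A trivial action has no entropy. -/
theorem topEntropy_nonpos_of_trivial {Y : Type u} [TopologicalSpace Y] [CompactSpace Y]
    [AddAction (ℤ × ℤ) Y] (h : ∀ (g : ℤ × ℤ) (y : Y), g +ᵥ y = y) : topEntropy Y ≤ 0 := by
  classical
  refine iSup_le fun ⟨𝒰, hopen, hcover⟩ => ?_
  obtain ⟨t, ht⟩ := isCompact_univ.elim_finite_subcover (fun U : 𝒰 => U.1)
    (fun U => hopen U.1 U.2) (by rw [← sUnion_eq_iUnion, hcover])
  refine coverEntropy_nonpos (C := (t.image Subtype.val).card) fun n hn => minCover_le ?_ ?_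
  · rintro U hU
    obtain ⟨U, -, rfl⟩ := Finset.mem_image.1 hU
    refine ⟨fun _ => U, fun _ => U.2, ?_⟩
    ext y
    simp only [h, mem_ofPred_eq]
    exact ⟨fun hy _ _ => hy, fun hy => hy (0, 0) (by
      simpa [Nat.pos_iff_ne_zero, Nat.one_le_iff_ne_zero] using hn)⟩
  · intro y hy
    obtain ⟨U, hU, hyU⟩ := mem_iUnion₂.1 (ht hy)
    exact ⟨U.1, Finset.mem_image_of_mem _ hU, hyU⟩

/-- The quotient of a compact Hausdorff space by a closed equivalence relation is Hausdorff. -/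
theorem t2Space_quotient_of_isClosed {Z : Type*} [TopologicalSpace Z] [CompactSpace Z] [T2Space Z]
    (s : Setoid Z) (hs : IsClosed {p : Z × Z | s p.1 p.2}) : T2Space (Quotient s) := by
  -- The saturation of a closed set is the projection of a compact set. Fibres are then closed, and
  -- disjoint open sets around two of them can be shrunk to saturated ones.
  have hq : IsClosedMap (Quotient.mk s) := fun F hF => by
    refine isQuotientMap_quotient_mk'.isClosed_preimage.1 ?_
    change IsClosed (Quotient.mk s ⁻¹' (Quotient.mk s '' F))
    have : Quotient.mk s ⁻¹' (Quotient.mk s '' F) =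
        Prod.snd '' ({p : Z × Z | s p.1 p.2} ∩ Prod.fst ⁻¹' F) := by
      ext z
      constructor
      · rintro ⟨w, hw, hwz⟩
        exact ⟨(w, z), ⟨Quotient.exact hwz, hw⟩, rfl⟩
      · rintro ⟨⟨w, z⟩, ⟨hwz, hw⟩, rfl⟩
        exact ⟨w, hw, Quotient.sound hwz⟩
    rw [this]
    exact ((hs.inter (hF.preimage continuous_fst)).isCompact.image continuous_snd).isClosed
  have hfib : ∀ z, IsClosed (Quotient.mk s ⁻¹' {Quotient.mk s z}) := fun z => by
    have := hq _ (isClosed_singleton (x := z))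
    rw [image_singleton] at this
    exact this.preimage continuous_quotient_mk'
  refine ⟨fun a b hab => ?_⟩
  obtain ⟨x, rfl⟩ := Quotient.exists_rep a
  obtain ⟨x', rfl⟩ := Quotient.exists_rep b
  obtain ⟨U, U', hU, hU', hxU, hxU', hdisj⟩ := SeparatedNhds.of_isCompact_isCompact
    (hfib x).isCompact (hfib x').isCompact
    (Disjoint.preimage _ (disjoint_singleton.2 hab))
  refine ⟨(Quotient.mk s '' Uᶜ)ᶜ, (Quotient.mk s '' U'ᶜ)ᶜ, (hq _ hU.isClosed_compl).isOpen_compl,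
    (hq _ hU'.isClosed_compl).isOpen_compl, ?_, ?_, ?_⟩
  · rintro ⟨u, hu, hux⟩
    exact hu (hxU hux)
  · rintro ⟨u, hu, hux⟩
    exact hu (hxU' hux)
  · rw [Set.disjoint_left]
    intro c hc hc'
    obtain ⟨w, rfl⟩ := Quotient.exists_rep c
    refine hdisj.notMem_of_mem_left (a := w) ?_ ?_
    · by_contra hw
      exact hc ⟨w, hw, rfl⟩
    · by_contra hw
      exact hc' ⟨w, hw, rfl⟩

/-- If `X` has completely positive entropy, then a closed equivalence relation on `X` whose classes
are shift-invariant is trivial, because the action on the quotient is trivial. -/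
theorem HasTCPE.eq_prod_of_isEquivOn [Finite A] [T2Space A] (hX : IsSubshift X) (h : HasTCPE X)
    {R : Set (Config A × Config A)} (hRX : R ⊆ X ×ˢ X) (hR : IsEquivOn X R) (hRc : IsClosed R)
    (hshift : ∀ g, ∀ x ∈ X, (x, shift g x) ∈ R) : R = X ×ˢ X := by
  refine hRX.antisymm ?_
  rintro ⟨a, b⟩ ⟨ha, hb⟩
  by_contra hab
  have : CompactSpace X := isCompact_iff_compactSpace.1 hX.isClosed.isCompact
  let s : Setoid X :=
    ⟨fun x y => (x.1, y.1) ∈ R, fun x => hR.1 x.1 x.2, fun h => hR.2.1 _ _ h,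
      fun h h' => hR.2.2 _ _ _ h h'⟩
  have : T2Space (Quotient s) := t2Space_quotient_of_isClosed s
    (hRc.preimage (f := fun p : X × X => (p.1.1, p.2.1)) (by fun_prop))
  have hne : Quotient.mk s ⟨a, ha⟩ ≠ Quotient.mk s ⟨b, hb⟩ := fun he => hab (Quotient.exact he)
  -- A Urysohn function separating two classes has a range in `ℝ`, which serves as a factor that is
  -- visibly metrizable.
  obtain ⟨f, hfa, hfb, -⟩ := exists_continuous_zero_one_of_isClosed
    (isClosed_singleton (x := Quotient.mk s ⟨a, ha⟩))
    (isClosed_singleton (x := Quotient.mk s ⟨b, hb⟩)) (disjoint_singleton.2 hne)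
  let φ : X → ℝ := fun x => f (Quotient.mk s x)
  have hφ : Continuous φ := f.continuous.comp continuous_quotient_mk'
  let Y := ULift.{u} (range φ)
  have : CompactSpace (range φ) := isCompact_iff_compactSpace.1 (isCompact_range hφ)
  have : CompactSpace Y := Homeomorph.ulift.symm.compactSpace
  let _ : AddAction (ℤ × ℤ) Y :=
    { vadd := fun _ y => y
      zero_vadd := fun _ => rfl
      add_vadd := fun _ _ _ => rfl }
  have : ContinuousConstVAdd (ℤ × ℤ) Y := ⟨fun _ => continuous_id⟩
  let π : X → Y := fun x => ⟨⟨φ x, x, rfl⟩⟩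
  refine (h Y π (continuous_uliftUp.comp (hφ.subtype_mk _)) ?_ ?_ ?_).not_ge
    (topEntropy_nonpos_of_trivial fun _ _ => rfl)
  · rintro ⟨⟨_, x, rfl⟩⟩
    exact ⟨x, rfl⟩
  · intro g x x' hx
    have he : Quotient.mk s x' = Quotient.mk s x := Quotient.sound (hR.2.1 _ _ (by
      rw [hx]
      exact hshift g x.1 x.2))
    exact congrArg ULift.up (Subtype.ext (congrArg f he))
  · refine ⟨π ⟨a, ha⟩, π ⟨b, hb⟩, fun he => ?_⟩
    have he : f (Quotient.mk s ⟨a, ha⟩) = f (Quotient.mk s ⟨b, hb⟩) :=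
      congrArg (fun y : Y => (y.down : ℝ)) he
    rw [hfa rfl, hfb rfl] at he
    exact zero_ne_one he

end Factors

end Fabric

end

/-! ### The main theorem -/

theorem mainTheorem6 {A : Type*} [Finite A] [TopologicalSpace A] [DiscreteTopology A]
    (W : Set (Fabric.Config A)) (hW : Fabric.IsSubshift W)
    (hμ : Fabric.HasFullySupportedMeasure W) :
    Fabric.IsSubshift (Fabric.fabricSet W) ∧
    (Fabric.HasTCPE (Fabric.fabricSet W) ↔ Fabric.IsGeneralizedTransitive W) ∧
    (Fabric.IsGeneralizedTransitive W →
      Fabric.tcpeRank (Fabric.fabricSet W) = Fabric.transitivityRank W) ∧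
    ∀ α : Ordinal.{0}, 1 ≤ α → α < Ordinal.omega 1 →
      Fabric.fabricRel (Fabric.T W α) = Fabric.E (Fabric.fabricSet W) α := by
  have hX := Fabric.isSubshift_fabricSet hW
  have hE := Fabric.fabricRel_T hW (Fabric.fabricRel_transitivityPairs hW hμ)
  have hprod : Fabric.IsShiftTolerance W (W ×ˢ W) :=
    ⟨subset_rfl, fun x hx => ⟨hx, hx⟩, fun p hp => ⟨hp.2, hp.1⟩,
      fun g h p hp => ⟨hW.shift_mem g _ hp.1, hW.shift_mem h _ hp.2⟩⟩
  have hiff : ∀ α, Fabric.E (Fabric.fabricSet W) α =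
      Fabric.fabricSet W ×ˢ Fabric.fabricSet W ↔ Fabric.T W α = W ×ˢ W := fun α => by
    rw [← hE, ← Fabric.fabricRel_prod, Fabric.fabricRel_inj (hW.isShiftTolerance_T α) hprod]
  refine ⟨hX, ⟨fun h => ?_, ?_⟩, fun _ => ?_, fun α _ _ => hE α⟩
  · obtain ⟨α, h1, hα, hclosed, htrans⟩ := Fabric.exists_isClosed_transClosure_eq W
    have hT := hW.isShiftTolerance_T α
    refine ⟨α, h1, hα, (Fabric.fabricRel_inj hT hprod).1 ?_⟩
    rw [Fabric.fabricRel_prod]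
    refine h.eq_prod_of_isEquivOn hX ?_ (Fabric.isEquivOn_fabricRel hT htrans)
      ((Fabric.isClosed_fabricRel_iff hW hT).2 hclosed) fun g y hy => ?_
    · rw [← Fabric.fabricRel_prod]
      exact Fabric.fabricRel_mono hT.subset
    -- A shifted fabric still prints the same `x`, so reflexivity of `T W α` puts each fabric and
    -- its shifts in one class.
    · obtain ⟨x, hx, hy⟩ := Fabric.mem_fabricSet.1 hy
      exact Fabric.mem_fabricRel.2 ⟨(x, x), hT.refl x hx, hy, Fabric.shift_mem_fabric g hy⟩
  · rintro ⟨α, -, -, h⟩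
    exact Fabric.hasTCPE_of_E_eq hX ((hiff α).2 h)
  · simp only [Fabric.tcpeRank, Fabric.transitivityRank, hiff]
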